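/- Let $M=(M_{ij})$ be an $(m\times n)$-matrix with integer entries and put $s_i=|M_{i1}|+\dots+|M_{in}|$ for $1\le i\le m$. An \emph{edge ordering} for $M$ consists, for every row $i$, of a sequence of $s_i$ labels from $\{1,\dots,n\}$ in which every $j$ occurs exactly $|M_{ij}|$ times. The \emph{matrix disc complex} of an edge ordering is the two-dimensional CW complex with a single $0$-cell, with one edge $a_j$ for every column $j$, both of whose ends are attached to the $0$-cell, and with one polygonal disc for every row $i$, whose boundary is divided into $s_i$ edges; the $k$-th of these is attached along $a_j$, where $j$ is the $k$-th label of row $i$, in the forward direction if $M_{ij}>0$ and in the reversed direction if $M_{ij}<0$. (If $s_i=0$, the boundary of the $i$-th disc is attached to the $0$-cell by the constant map.) Let $DC(M)$ be the set of the matrix disc complexes of all edge orderings for $M$. Then all complexes in $DC(M)$ have the same integer homology: for all $C,C'\in DC(M)$ and all $k\ge 0$, $H_k(C;\mathbb Z)\cong H_k(C';\mathbb Z)$. More precisely, for every $C\in DC(M)$: - $H_0(C;\mathbb Z)\cong\mathbb Z$; - $H_1(C;\mathbb Z)\cong\mathbb Z^n/R$, where $R$ is the subgroup of $\mathbb Z^n$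 generated by the rows of $M$; that is, $H_1(C;\mathbb Z)$ is isomorphic to the abelian group with generators $a_1,\dots,a_n$ and the relations $\sum_{j} M_{ij}a_j=0$, $1\le i\le m$; - $H_2(C;\mathbb Z)\cong\{x\in\mathbb Z^m : xM=0\}$, with $x$ regarded as a row vector; - $H_k(C;\mathbb Z)=0$ for all $k\ge 3$. -/

import Mathlib

/-- The row sum `s_i = |M_{i1}| + ⋯ + |M_{in}|`: the number of edges of the `i`-th polygonal disc. -/
def Matrix.discSize {m n : ℕ} (M : Matrix (Fin m) (Fin n) ℤ) (i : Fin m) : ℕ :=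
  ∑ j, (M i j).natAbs

/-- A choice, for every row `i` of `M`, of the sequence of labels of the `s_i` edges met when one
travels once around the `i`-th polygonal disc. The label `j` (that is, the edge cycle `a_j`) has to
occur exactly `|M_{ij}|` times. The direction of the edges is not a choice: an edge of disc `i`
labelled `j` is traversed forwards if `M_{ij} > 0` and backwards if `M_{ij} < 0`. -/
structure EdgeOrdering {m n : ℕ} (M : Matrix (Fin m) (Fin n) ℤ) where
  /-- the label of the `k`-th edge of the `i`-th disc -/
  label : (i : Fin m) → Fin (M.discSize i) → Fin n
  card_label : ∀ i j, (Finset.univ.filter fun k => label i k = j).card = (M i j).natAbs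

namespace MatrixDiscComplex

/-- The closed two-dimensional unit disc. -/
abbrev Disc : Type := Metric.closedBall (0 : ℂ) 1

/-- The point of the boundary circle of the disc at angle `2πθ`. -/
noncomputable def boundaryPoint (θ : ℝ) : Disc :=
  ⟨(Circle.exp (2 * Real.pi * θ) : ℂ), mem_closedBall_zero_iff.2 (Circle.norm_coe _).le⟩

/-- The disjoint union of the closed cells: one point, an interval for every column, and a disc
for every row. -/
abbrev Cells (m n : ℕ) : Type :=
  Unit ⊕ (Fin n × unitInterval) ⊕ (Fin m × Disc)

/-- The single `0`-cell. -/
def vertex {m n : ℕ} : Cells m n := Sum.inl ()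

/-- The point with parameter `t` of the edge `a_j`. -/
def edge {m n : ℕ} (j : Fin n) (t : unitInterval) : Cells m n := Sum.inr (Sum.inl (j, t))

/-- The point `z` of the `i`-th disc. -/
def disc {m n : ℕ} (i : Fin m) (z : Disc) : Cells m n := Sum.inr (Sum.inr (i, z))

variable {m n : ℕ} {M : Matrix (Fin m) (Fin n) ℤ}

/-- The gluing. Both ends of every edge are attached to the vertex. The boundary circle of the
`i`-th disc is divided into `s_i` arcs of equal length, and the `k`-th arc is attached along the
edge that `E` prescribes, forwards or backwards according to the sign of the matrix entry.
If `s_i = 0`, the boundary of the `i`-th disc is attached to the vertex by the constant map. -/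
inductive Glue (E : EdgeOrdering M) : Cells m n → Cells m n → Prop
  | edge_start (j : Fin n) : Glue E (edge j 0) vertex
  | edge_end (j : Fin n) : Glue E (edge j 1) vertex
  | disc_forward (i : Fin m) (k : Fin (M.discSize i)) (t : unitInterval)
      (h : 0 < M i (E.label i k)) :
      Glue E (disc i (boundaryPoint (((k : ℕ) + (t : ℝ)) / (M.discSize i : ℝ))))
        (edge (E.label i k) t)
  | disc_backward (i : Fin m) (k : Fin (M.discSize i)) (t : unitInterval)
      (h : M i (E.label i k) < 0) :
      Glue E (disc i (boundaryPoint (((k : ℕ) + (t : ℝ)) / (M.discSize i : ℝ))))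
        (edge (E.label i k) (unitInterval.symm t))
  | disc_collapse (i : Fin m) (h : M.discSize i = 0) (θ : ℝ) :
      Glue E (disc i (boundaryPoint θ)) vertex

end MatrixDiscComplex

/-- The two-dimensional CW complex that an edge ordering determines: the disjoint union of the
closed cells modulo the equivalence relation generated by the gluing, with the quotient topology. -/
abbrev EdgeOrdering.toComplex {m n : ℕ} {M : Matrix (Fin m) (Fin n) ℤ} (E : EdgeOrdering M) :
    Type :=
  Quot (MatrixDiscComplex.Glue E)

/-- `DC(M)`: the set of matrix disc complexes associated with `M`, one for every edge ordering. -/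
def Matrix.DC {m n : ℕ} (M : Matrix (Fin m) (Fin n) ℤ) : Set TopCat.{0} :=
  Set.range fun E : EdgeOrdering M => TopCat.of E.toComplex

/-- The `k`-th integral (singular) homology group of a topological space. -/
noncomputable abbrev integerHomology (k : ℕ) (X : TopCat.{0}) : ModuleCat.{0} ℤ :=
  ((AlgebraicTopology.singularHomologyFunctor (ModuleCat.{0} ℤ) k).obj (ModuleCat.of ℤ ℤ)).obj X

/-! The proof compares the singular chains of a matrix disc complex `X` with its cellular chain
complex `ℤᵐ → ℤⁿ → ℤ`, whose second boundary map is multiplication of row vectors by `M` and whose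
first boundary map vanishes, since every edge is a loop. The point is that the cellular complex
does not see in which order the edges follow each other around a disc: the boundary loop of the
`i`-th disc is a concatenation of edge loops and their reverses, hence homologous to
`∑ j, M i j • a j` (`EdgeOrdering.path_boundary_sub_mem`), whatever the order is.

Mathlib has homotopy invariance of singular homology, but neither excision nor cellular homology, so
these are built here. The singular chain complex is replaced by the isomorphic complex `singChains`,
whose chains are literally finitely supported functions on continuous maps. Excision
(`quasiIso_excision`) is proved by iterated barycentric subdivision: subdivision is defined for
affine chains in a simplex by coning off the subdivided boundary, it shrinks the mesh, and by the
Lebesgue number lemma every singular chain becomes small with respect to an open cover of two sets.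
Together with homotopy invariance this shows that gluing a pair `(P, B)`, with `B` collared in
`P`, to another space does not change its relative chains up to quasi-isomorphism
(`IsAttaching.quasiIso_relMap`).

The comparison with cellular chains uses no homology groups, only quasi-isomorphisms from explicit
complexes `triple f g w` with at most three nonzero terms. By the five lemma, such a model of `A`
and one of the pair `(P, B)` combine to one of the space obtained by attaching `P` to `A`
(`quasiIso_relative₁`, `quasiIso_relative₂`). This is applied to intervals
(`quasiIso_graph`), which gives a model of a circle and of the one-skeleton of `X`, and then to
discs (`IsAttaching.exists_quasiIso`). A model of the pairs `(interval, endpoints)` and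
`(disc, circle)` is obtained because intervals and discs are contractible. That `X` is obtained by
attaching edges and discs in the required sense is point-set topology of the quotient
(`EdgeOrdering.isAttaching_edgeMap`, `EdgeOrdering.isAttaching_discMap`); the main point there
is that the gluing identifies no two points in the interiors of edges or discs. -/

open CategoryTheory Limits HomologicalComplex HomologySequence ZeroObject Topology

/-! ### Singular chains -/

/-- The standard topological `n`-simplex. -/
abbrev Splx (n : ℕ) : Type := stdSimplex ℝ (Fin (n + 1))

/-- The map of standard simplices induced by a map of vertices. -/
noncomputable def splxMap {k n : ℕ} (f : Fin (k + 1) → Fin (n + 1)) : C(Splx k, Splx n) :=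
  ⟨stdSimplex.map f, stdSimplex.continuous_map f⟩

/-- The singular simplicial set, whose `n`-simplices are literally the continuous maps from the
standard simplex. -/
noncomputable def singularSet : TopCat.{0} ⥤ SimplicialObject (Type 0) where
  obj X :=
    { obj := fun n => C(Splx n.unop.len, X)
      map := fun f => TypeCat.ofHom (fun σ => σ.comp (splxMap f.unop.toOrderHom))
      map_id := fun n => by
        ext σ t
        change σ (stdSimplex.map id t) = σ t
        rw [stdSimplex.map_id_apply]
      map_comp := fun f g => by
        ext σ t
        change σ (stdSimplex.map (f.unop.toOrderHom ∘ g.unop.toOrderHom) t) =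
          σ (stdSimplex.map f.unop.toOrderHom (stdSimplex.map g.unop.toOrderHom t))
        rw [stdSimplex.map_comp_apply] }
  map f := { app := fun n => TypeCat.ofHom (fun σ => f.hom.comp σ), naturality := fun _ _ _ => rfl }
  map_id X := rfl
  map_comp f g := rfl

/-- `singularSet` is Mathlib's singular simplicial set. -/
noncomputable def singularSetIso : TopCat.toSSet.{0} ≅ singularSet :=
  NatIso.ofComponents
    (fun X => NatIso.ofComponents (fun n => (X.toSSetObjEquiv n).toIso) (fun _ => rfl) )
    (fun _ => rfl)

/-- Coproducts of copies of `ℤ` are free modules. -/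
noncomputable def sigmaIsoFinsupp (S : Type) :
    (∐ fun _ : S => ModuleCat.of ℤ ℤ) ≅ ModuleCat.of ℤ (S →₀ ℤ) where
  hom := Sigma.desc fun x : S => ModuleCat.ofHom (Finsupp.lsingle x)
  inv := ModuleCat.ofHom (Finsupp.lsum ℕ fun x : S =>
    (Sigma.ι (fun _ : S => ModuleCat.of ℤ ℤ) x).hom)
  hom_inv_id := by
    apply Sigma.hom_ext
    intro x
    rw [Sigma.ι_desc_assoc, Category.comp_id]
    ext
    simp
  inv_hom_id := by
    apply ModuleCat.hom_ext
    apply Finsupp.lhom_ext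
    intro x y
    have := congrArg (fun f => f.hom y) (Sigma.ι_desc (fun x : S =>
      ModuleCat.ofHom (Finsupp.lsingle (R := ℤ) (M := ℤ) x)) x)
    simpa [-colimit.ι_desc, -colimit.ι_desc_apply] using this

/-- The functor taking coproducts of copies of `ℤ` is the free module functor. -/
noncomputable def sigmaConstIsoFree :
    (sigmaConst.obj (ModuleCat.of ℤ ℤ) : Type 0 ⥤ ModuleCat.{0} ℤ) ≅ ModuleCat.free ℤ :=
  NatIso.ofComponents sigmaIsoFinsupp
    (fun {S T} f => by
      apply Sigma.hom_ext
      intro x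
      have h1 : (sigmaConst.obj (ModuleCat.of ℤ ℤ)).map f =
        Sigma.desc fun x : S => Sigma.ι (fun _ : T => ModuleCat.of ℤ ℤ) (f x) := by
        apply Sigma.hom_ext
        intro x
        simp [sigmaConst]
      have h2 : (ModuleCat.free ℤ).map f = ModuleCat.ofHom (Finsupp.lmapDomain ℤ ℤ f) := rfl
      rw [h1, h2]
      erw [Sigma.ι_desc_assoc, Sigma.ι_desc, Sigma.ι_desc_assoc]
      apply ModuleCat.hom_ext
      refine LinearMap.ext_ring ?_
      exact (Finsupp.mapDomain_single (f := f) (a := x) (b := (1 : ℤ))).symm)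

/-- The singular chain complex with integer coefficients, with the module of `n`-chains being
literally the finitely supported functions on the continuous maps from the standard simplex. -/
noncomputable def singChains : TopCat.{0} ⥤ ChainComplex (ModuleCat.{0} ℤ) ℕ :=
  singularSet ⋙ (SimplicialObject.whiskering _ _).obj (ModuleCat.free ℤ) ⋙
    AlgebraicTopology.alternatingFaceMapComplex _

/-- `singChains` is Mathlib's singular chain complex. -/
noncomputable def singChainsIso :
    (AlgebraicTopology.singularChainComplexFunctor (ModuleCat.{0} ℤ)).obj (ModuleCat.of ℤ ℤ) ≅
      singChains :=
  Functor.isoWhiskerRight singularSetIso ((SimplicialObject.whiskering _ _).obj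
      (sigmaConst.obj (ModuleCat.of ℤ ℤ)) ⋙ AlgebraicTopology.alternatingFaceMapComplex _) ≪≫
    Functor.isoWhiskerLeft singularSet (Functor.isoWhiskerRight
      ((SimplicialObject.whiskering _ _).mapIso sigmaConstIsoFree)
      (AlgebraicTopology.alternatingFaceMapComplex _))

namespace SingChain

variable {X Y : TopCat.{0}} {n : ℕ}

/-- The chain consisting of a single simplex. -/
noncomputable def of (σ : C(Splx n, X)) : (singChains.obj X).X n :=
  (Finsupp.single σ 1 : C(Splx n, X) →₀ ℤ)

/-- The `i`-th face inclusion. -/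
noncomputable abbrev face (i : Fin (n + 2)) : C(Splx n, Splx (n + 1)) := splxMap i.succAbove

lemma d_of (σ : C(Splx (n + 1), X)) :
    (singChains.obj X).d (n + 1) n (of σ) =
      ∑ i : Fin (n + 2), (-1 : ℤ) ^ (i : ℕ) • of (σ.comp (face i)) := by
  have h := (congrArg ModuleCat.Hom.hom (AlgebraicTopology.AlternatingFaceMapComplex.obj_d_eq
    (((SimplicialObject.whiskering _ _).obj (ModuleCat.free ℤ)).obj (singularSet.obj X)) n)).trans
      (ModuleCat.hom_sum _ _)
  refine (LinearMap.congr_fun h (of σ)).trans ((LinearMap.sum_apply _ _ _).trans ?_)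
  refine Finset.sum_congr rfl fun i _ => ?_
  exact congrArg (fun z : C(Splx n, X) →₀ ℤ => (-1 : ℤ) ^ (i : ℕ) • z)
    (Finsupp.mapDomain_single (f := fun τ : C(Splx (n + 1), X) => τ.comp (face i)))

lemma map_of (f : X ⟶ Y) (σ : C(Splx n, X)) :
    (singChains.map f).f n (of σ) = of (f.hom.comp σ) :=
  Finsupp.mapDomain_single

lemma map_injective (f : X ⟶ Y) (hf : Function.Injective f) (n : ℕ) :
    Function.Injective ((singChains.map f).f n) := by
  refine Finsupp.mapDomain_injective (M := ℤ) (f := fun σ : C(Splx n, X) => f.hom.comp σ) ?_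
  intro σ τ h
  ext t
  exact hf (DFunLike.congr_fun h t)

lemma hom_ext {M : Type*} [AddCommGroup M] [Module ℤ M] {f g : (singChains.obj X).X n →ₗ[ℤ] M}
    (h : ∀ σ, f (of σ) = g (of σ)) : f = g := by
  apply Finsupp.lhom_ext'
  intro σ
  ext
  exact h σ

/-- The linear map on chains with given values on simplices. -/
noncomputable def lift {M : Type*} [AddCommGroup M] [Module ℤ M] (g : C(Splx n, X) → M) :
    (singChains.obj X).X n →ₗ[ℤ] M :=
  Finsupp.linearCombination ℤ g

@[simp] lemma lift_of {M : Type*} [AddCommGroup M] [Module ℤ M] (g : C(Splx n, X) → M)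
    (σ : C(Splx n, X)) :
    lift g (of σ) = g σ := by
  refine (Finsupp.linearCombination_single ℤ _ _).trans
    (@one_smul ℤ M _ Module.toDistribMulAction.toMulAction _)

/-- The chains supported on a set of simplices. -/
noncomputable def supp (s : Set C(Splx n, X)) : Submodule ℤ ((singChains.obj X).X n) :=
  Finsupp.supported ℤ ℤ s

lemma supp_eq_span (s : Set C(Splx n, X)) : supp s = Submodule.span ℤ (of '' s) :=
  Finsupp.supported_eq_span_single ℤ s

lemma range_map (f : X ⟶ Y) :
    LinearMap.range ((singChains.map f).f n).hom =
      supp (Set.range fun σ : C(Splx n, X) => f.hom.comp σ) := by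
  have := Finsupp.lmapDomain_supported (M := ℤ) (R := ℤ) (fun σ : C(Splx n, X) => f.hom.comp σ)
    Set.univ
  rw [Finsupp.supported_univ, Submodule.map_top, Set.image_univ] at this
  exact this

end SingChain

/-! ### Affine chains in a simplex and their barycentric subdivision -/

/-- The affine map between standard simplices with given values on the vertices. -/
noncomputable def affMap {ι : Type*} [Fintype ι] {n : ℕ} (v : ι → Splx n) :
    C(stdSimplex ℝ ι, Splx n) where
  toFun t := ⟨∑ i, t.1 i • (v i).1,
    (convex_stdSimplex ℝ (Fin (n + 1))).sum_mem (fun i _ => t.2.1 i) t.2.2 fun i _ => (v i).2⟩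
  continuous_toFun := by
    have h : ∀ i, Continuous fun t : stdSimplex ℝ ι => t.1 i := fun i =>
      (continuous_apply i).comp continuous_subtype_val
    exact Continuous.subtype_mk (continuous_finsetSum _ fun i _ => (h i).smul continuous_const) _

section affMap

variable {ι κ : Type*} [Fintype ι] [Fintype κ] {n m : ℕ}

lemma affMap_val (v : ι → Splx n) (t : stdSimplex ℝ ι) :
    (affMap v t).1 = ∑ i, t.1 i • (v i).1 := rfl

lemma affMap_affMap (w : Fin (n + 1) → Splx m) (v : ι → Splx n) (t : stdSimplex ℝ ι) :
    affMap w (affMap v t) = affMap (fun i => affMap w (v i)) t := by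
  apply Subtype.ext
  rw [affMap_val, affMap_val]
  simp only [affMap_val, Finset.sum_apply, Pi.smul_apply, smul_eq_mul, Finset.smul_sum,
    Finset.sum_smul]
  rw [Finset.sum_comm]
  simp only [mul_smul]

lemma affMap_map (v : κ → Splx n) (f : ι → κ) (t : stdSimplex ℝ ι) :
    affMap v (stdSimplex.map f t) = affMap (v ∘ f) t := by
  classical
  apply Subtype.ext
  rw [affMap_val, affMap_val]
  have h : ∀ j, (stdSimplex.map f t).1 j = ∑ i with f i = j, t.1 i := fun j =>
    FunOnFinite.linearMap_apply_apply ℝ ℝ f t.1 j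
  simp only [h, Finset.sum_smul]
  rw [← Finset.sum_fiberwise_of_maps_to (t := Finset.univ) (g := f) (fun _ _ => Finset.mem_univ _)]
  refine Finset.sum_congr rfl fun j _ => Finset.sum_congr rfl fun i hi => ?_
  rw [Function.comp_apply, (Finset.mem_filter.1 hi).2]

lemma affMap_vertex [DecidableEq ι] (v : ι → Splx n) (i : ι) :
    affMap v (stdSimplex.vertex i) = v i := by
  apply Subtype.ext
  rw [affMap_val, Finset.sum_eq_single i]
  · change (Pi.single i (1 : ℝ) : ι → ℝ) i • _ = _
    simp
  · intro j _ hj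
    change (Pi.single i (1 : ℝ) : ι → ℝ) j • _ = _
    simp [hj]
  · simp

lemma affMap_vertices (t : Splx n) : affMap (fun i => stdSimplex.vertex (S := ℝ) i) t = t := by
  apply Subtype.ext
  rw [affMap_val]
  ext j
  rw [Finset.sum_apply]
  change ∑ i, t.1 i * (Pi.single i (1 : ℝ) : Fin (n + 1) → ℝ) j = _
  simp [Pi.single_apply]

end affMap

/-- The module of affine chains with `k` vertices (one more than the dimension) in the standard
`n`-simplex. The case `k = 0` is included, which makes this the augmented complex. -/
abbrev AffChain (n k : ℕ) : Type := (Fin k → Splx n) →₀ ℤ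

namespace AffChain

variable {n m k : ℕ}

/-- The affine simplex with vertices `v`, as a chain. -/
noncomputable def of (v : Fin k → Splx n) : AffChain n k := Finsupp.single v 1

lemma hom_ext {M : Type*} [AddCommGroup M] [Module ℤ M] {f g : AffChain n k →ₗ[ℤ] M}
    (h : ∀ v, f (of v) = g (of v)) : f = g := by
  apply Finsupp.lhom_ext'
  intro σ
  ext
  exact h σ

/-- The linear map with given values on affine simplices. -/
noncomputable def lift {M : Type*} [AddCommGroup M] [Module ℤ M] (g : (Fin k → Splx n) → M) :
    AffChain n k →ₗ[ℤ] M :=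
  Finsupp.linearCombination ℤ g

@[simp] lemma lift_of {M : Type*} [AddCommGroup M] [Module ℤ M] (g : (Fin k → Splx n) → M)
    (v : Fin k → Splx n) : lift g (of v) = g v :=
  (Finsupp.linearCombination_single ℤ _ _).trans
    (@one_smul ℤ M _ Module.toDistribMulAction.toMulAction _)

/-- The augmented boundary operator. -/
noncomputable def bd (n k : ℕ) : AffChain n (k + 1) →ₗ[ℤ] AffChain n k :=
  lift fun v => ∑ i : Fin (k + 1), (-1 : ℤ) ^ (i : ℕ) • of (v ∘ i.succAbove)

lemma bd_of (v : Fin (k + 1) → Splx n) :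
    bd n k (of v) = ∑ i : Fin (k + 1), (-1 : ℤ) ^ (i : ℕ) • of (v ∘ i.succAbove) := lift_of _ _

/-- The cone with apex `b`. -/
noncomputable def cone (b : Splx n) : AffChain n k →ₗ[ℤ] AffChain n (k + 1) :=
  lift fun v => of (Fin.cons b v)

@[simp] lemma cone_of (b : Splx n) (v : Fin k → Splx n) : cone b (of v) = of (Fin.cons b v) :=
  lift_of _ _

lemma bd_cone_zero (b : Splx n) (c : AffChain n 0) : bd n 0 (cone b c) = c := by
  refine LinearMap.congr_fun (f := bd n 0 ∘ₗ cone b) (g := LinearMap.id) (hom_ext fun v => ?_) c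
  simp only [LinearMap.comp_apply, cone_of, bd_of, LinearMap.id_apply]
  rw [Fin.sum_univ_one, Fin.val_zero, pow_zero, one_smul]
  exact congrArg of (Subsingleton.elim _ _)

lemma bd_cone (b : Splx n) (c : AffChain n (k + 1)) :
    bd n (k + 1) (cone b c) = c - cone b (bd n k c) := by
  refine LinearMap.congr_fun (f := bd n (k + 1) ∘ₗ cone b) (g := LinearMap.id - cone b ∘ₗ bd n k)
    (hom_ext fun v => ?_) c
  simp only [LinearMap.comp_apply, cone_of, bd_of, LinearMap.id_apply, LinearMap.sub_apply,
    map_sum, map_zsmul]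
  rw [Fin.sum_univ_succ, sub_eq_add_neg, ← Finset.sum_neg_distrib]
  congr 1
  · rw [Fin.val_zero, pow_zero, one_smul]
    congr 1
  · refine Finset.sum_congr rfl fun i _ => ?_
    rw [Fin.val_succ, pow_succ, mul_neg_one, neg_smul]
    congr 3
    funext j
    refine Fin.cases ?_ (fun j => ?_) j
    · simp
    · simp

lemma bd_bd (c : AffChain n (k + 2)) : bd n k (bd n (k + 1) c) = 0 := by
  induction k with
  | zero =>
    refine LinearMap.congr_fun (f := bd n 0 ∘ₗ bd n 1) (g := 0) (hom_ext fun v => ?_) c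
    rw [LinearMap.comp_apply, ← Fin.cons_self_tail v, ← cone_of, bd_cone, map_sub, bd_cone_zero,
      sub_self, LinearMap.zero_apply]
  | succ k ih =>
    refine LinearMap.congr_fun (f := bd n (k + 1) ∘ₗ bd n (k + 2)) (g := 0)
      (hom_ext fun v => ?_) c
    rw [LinearMap.comp_apply, ← Fin.cons_self_tail v, ← cone_of, bd_cone, map_sub, bd_cone, ih,
      map_zero, sub_zero, sub_self, LinearMap.zero_apply]

/-- The barycenter of an affine simplex. -/
noncomputable def bary (v : Fin (k + 1) → Splx n) : Splx n := affMap v stdSimplex.barycenter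

/-- Barycentric subdivision of affine chains: the cone over the subdivided boundary. -/
noncomputable def sd (n : ℕ) : ∀ k, AffChain n k →ₗ[ℤ] AffChain n k
  | 0 => LinearMap.id
  | k + 1 => lift fun v => cone (bary v) (sd n k (bd n k (of v)))

lemma sd_of (v : Fin (k + 1) → Splx n) :
    sd n (k + 1) (of v) = cone (bary v) (sd n k (bd n k (of v))) := lift_of _ _

/-- The chain homotopy between the identity and barycentric subdivision. -/
noncomputable def sdHtpy (n : ℕ) : ∀ k, AffChain n k →ₗ[ℤ] AffChain n (k + 1)
  | 0 => 0
  | k + 1 => lift fun v => cone (bary v) (of v - sdHtpy n k (bd n k (of v)))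

lemma sdHtpy_of (v : Fin (k + 1) → Splx n) :
    sdHtpy n (k + 1) (of v) = cone (bary v) (of v - sdHtpy n k (bd n k (of v))) := lift_of _ _

lemma bd_sd (c : AffChain n (k + 1)) : bd n k (sd n (k + 1) c) = sd n k (bd n k c) := by
  induction k with
  | zero =>
    refine LinearMap.congr_fun (f := bd n 0 ∘ₗ sd n 1) (g := sd n 0 ∘ₗ bd n 0)
      (hom_ext fun v => ?_) c
    rw [LinearMap.comp_apply, sd_of, bd_cone_zero]
    rfl
  | succ k ih =>
    refine LinearMap.congr_fun (f := bd n (k + 1) ∘ₗ sd n (k + 2))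
      (g := sd n (k + 1) ∘ₗ bd n (k + 1)) (hom_ext fun v => ?_) c
    rw [LinearMap.comp_apply, sd_of, bd_cone, ih, bd_bd, map_zero, map_zero, sub_zero]
    rfl

lemma bd_sdHtpy (c : AffChain n (k + 1)) :
    bd n (k + 1) (sdHtpy n (k + 1) c) = c - sd n (k + 1) c - sdHtpy n k (bd n k c) := by
  induction k with
  | zero =>
    refine LinearMap.congr_fun (f := bd n 1 ∘ₗ sdHtpy n 1)
      (g := LinearMap.id - sd n 1 - sdHtpy n 0 ∘ₗ bd n 0) (hom_ext fun v => ?_) c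
    have h (c) : sdHtpy n 0 c = 0 := rfl
    have h' (c) : sd n 0 c = c := rfl
    simp only [LinearMap.comp_apply, LinearMap.sub_apply, LinearMap.id_apply]
    rw [sdHtpy_of, sd_of, h, h', sub_zero, sub_zero, bd_cone]
  | succ k ih =>
    refine LinearMap.congr_fun (f := bd n (k + 2) ∘ₗ sdHtpy n (k + 2))
      (g := LinearMap.id - sd n (k + 2) - sdHtpy n (k + 1) ∘ₗ bd n (k + 1))
      (hom_ext fun v => ?_) c
    simp only [LinearMap.comp_apply, LinearMap.sub_apply, LinearMap.id_apply]
    rw [sdHtpy_of, bd_cone, map_sub (bd n (k + 1)), ih, bd_bd, map_zero, sub_zero, sub_sub_cancel,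
      ← sd_of]
    abel

/-- The effect on affine chains of an affine map. -/
noncomputable def map (w : Fin (n + 1) → Splx m) : AffChain n k →ₗ[ℤ] AffChain m k :=
  lift fun v => of fun i => affMap w (v i)

@[simp] lemma map_of (w : Fin (n + 1) → Splx m) (v : Fin k → Splx n) :
    map w (of v) = of fun i => affMap w (v i) := lift_of _ _

lemma map_bd (w : Fin (n + 1) → Splx m) (c : AffChain n (k + 1)) :
    map w (bd n k c) = bd m k (map w c) := by
  refine LinearMap.congr_fun (f := map w ∘ₗ bd n k) (g := bd m k ∘ₗ map w) (hom_ext fun v => ?_) c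
  simp only [LinearMap.comp_apply, map_of, bd_of, map_sum, map_zsmul]
  rfl

lemma map_cone (w : Fin (n + 1) → Splx m) (b : Splx n) (c : AffChain n k) :
    map w (cone b c) = cone (affMap w b) (map w c) := by
  refine LinearMap.congr_fun (f := map w ∘ₗ cone b) (g := cone (affMap w b) ∘ₗ map w)
    (hom_ext fun v => ?_) c
  simp only [LinearMap.comp_apply, map_of, cone_of]
  congr 1
  funext i
  refine Fin.cases ?_ (fun i => ?_) i <;> simp

lemma affMap_bary (w : Fin (n + 1) → Splx m) (v : Fin (k + 1) → Splx n) :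
    affMap w (bary v) = bary fun i => affMap w (v i) := affMap_affMap _ _ _

lemma map_sd (w : Fin (n + 1) → Splx m) (c : AffChain n k) :
    map w (sd n k c) = sd m k (map w c) := by
  induction k with
  | zero => rfl
  | succ k ih =>
    refine LinearMap.congr_fun (f := map w ∘ₗ sd n (k + 1)) (g := sd m (k + 1) ∘ₗ map w)
      (hom_ext fun v => ?_) c
    simp only [LinearMap.comp_apply, map_of, sd_of, map_cone, ih, map_bd, affMap_bary]

lemma map_sdHtpy (w : Fin (n + 1) → Splx m) (c : AffChain n k) :
    map w (sdHtpy n k c) = sdHtpy m k (map w c) := by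
  induction k with
  | zero => simp [sdHtpy]
  | succ k ih =>
    refine LinearMap.congr_fun (f := map w ∘ₗ sdHtpy n (k + 1)) (g := sdHtpy m (k + 1) ∘ₗ map w)
      (hom_ext fun v => ?_) c
    simp only [LinearMap.comp_apply, map_of, sdHtpy_of, map_cone, map_sub, ih, map_bd,
      affMap_bary]

/-- The affine chains supported on a set of affine simplices. -/
noncomputable def supp (s : Set (Fin k → Splx n)) : Submodule ℤ (AffChain n k) :=
  Submodule.span ℤ (of '' s)

lemma of_mem_supp {s : Set (Fin k → Splx n)} {v : Fin k → Splx n} (hv : v ∈ s) :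
    of v ∈ supp s := Submodule.subset_span ⟨v, hv, rfl⟩

lemma mem_supp_univ (c : AffChain n k) : c ∈ supp Set.univ := by
  induction c using Finsupp.induction_linear with
  | zero => exact Submodule.zero_mem _
  | add x y hx hy => exact Submodule.add_mem _ hx hy
  | single v a =>
    have : Finsupp.single v a = a • of v := (Finsupp.smul_single_one v a).symm
    rw [this]
    exact Submodule.smul_mem _ _ (of_mem_supp trivial)

lemma map_mem_of_mem_supp {M : Type*} [AddCommGroup M] [Module ℤ M] {s : Set (Fin k → Splx n)}
    {c : AffChain n k} (hc : c ∈ supp s) (f : AffChain n k →ₗ[ℤ] M) (N : Submodule ℤ M)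
    (h : ∀ v ∈ s, f (of v) ∈ N) : f c ∈ N := by
  have : supp s ≤ N.comap f := Submodule.span_le.2 (by rintro _ ⟨v, hv, rfl⟩; exact h v hv)
  exact this hc

lemma dist_affMap_le {ι : Type*} [Fintype ι] (v : ι → Splx n) (t : stdSimplex ℝ ι) (x : Splx n)
    {r : ℝ} (h : ∀ i, dist (v i) x ≤ r) : dist (affMap v t) x ≤ r := by
  have : (affMap v t).1 ∈ Metric.closedBall x.1 r :=
    (convex_closedBall _ _).sum_mem (fun i _ => t.2.1 i) t.2.2 fun i _ => h i
  exact this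

lemma dist_bary_le (v : Fin (k + 1) → Splx n) {d : ℝ} (h : ∀ i j, dist (v i) (v j) ≤ d)
    (i : Fin (k + 1)) : dist (v i) (bary v) ≤ (k : ℝ) / (k + 1) * d := by
  have hk : (0 : ℝ) < k + 1 := by positivity
  rw [dist_comm]
  have e : (bary v).1 - (v i).1 =
      ∑ j, ((k : ℝ) + 1)⁻¹ • ((v j).1 - (v i).1) := by
    rw [← Finset.smul_sum, Finset.sum_sub_distrib, smul_sub]
    congr 1
    · rw [bary, affMap_val, Finset.smul_sum]
      refine Finset.sum_congr rfl fun j _ => ?_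
      congr 1
      refine (stdSimplex.barycenter_apply j).trans ?_
      simp
    · rw [Finset.sum_const, Finset.card_univ, Fintype.card_fin, ← Nat.cast_smul_eq_nsmul ℝ,
        smul_smul]
      push_cast
      rw [inv_mul_cancel₀ hk.ne', one_smul]
  rw [Subtype.dist_eq, dist_eq_norm, e]
  calc _ ≤ ∑ j, ‖((k : ℝ) + 1)⁻¹ • ((v j).1 - (v i).1)‖ := norm_sum_le _ _
    _ ≤ ∑ j, ((k : ℝ) + 1)⁻¹ * (if j = i then 0 else d) := by
      refine Finset.sum_le_sum fun j _ => ?_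
      rw [norm_smul, Real.norm_of_nonneg (by positivity)]
      refine mul_le_mul_of_nonneg_left ?_ (by positivity)
      split_ifs with hj
      · simp [hj]
      · rw [← dist_eq_norm]; exact h j i
    _ = _ := by
      rw [← Finset.mul_sum, Finset.sum_ite, Finset.sum_const_zero, zero_add, Finset.sum_const,
        Finset.filter_ne', Finset.card_erase_of_mem (Finset.mem_univ _), Finset.card_univ,
        Fintype.card_fin, Nat.add_sub_cancel, nsmul_eq_mul]
      field_simp

/-- Subdivision of a simplex with `k` vertices shrinks the mesh by the factor `(k - 1) / k`. -/
lemma sd_of_mem_supp (v : Fin k → Splx n) {d : ℝ} (hd : 0 ≤ d) (h : ∀ i j, dist (v i) (v j) ≤ d) :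
    sd n k (of v) ∈ supp {w : Fin k → Splx n | (∀ j, w j ∈ Set.range (affMap v)) ∧
      ∀ i j, dist (w i) (w j) ≤ ((k : ℝ) - 1) / k * d} := by
  induction k with
  | zero => exact of_mem_supp ⟨fun j => j.elim0, fun j => j.elim0⟩
  | succ k ih =>
    rw [sd_of, bd_of, map_sum, map_sum]
    refine Submodule.sum_mem _ fun i _ => ?_
    rw [map_zsmul, map_zsmul]
    refine Submodule.smul_mem _ _ ?_
    refine map_mem_of_mem_supp (ih (v ∘ i.succAbove) fun _ _ => h _ _) (cone (bary v)) _ ?_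
    rintro w ⟨hw1, hw2⟩
    rw [cone_of]
    have hr : ∀ j, w j ∈ Set.range (affMap v) := fun j => by
      obtain ⟨t, ht⟩ := hw1 j
      exact ⟨stdSimplex.map i.succAbove t, by rw [affMap_map, ht]⟩
    have hb : ∀ j, dist (w j) (bary v) ≤ (((k + 1 : ℕ) : ℝ) - 1) / (k + 1 : ℕ) * d := fun j => by
      obtain ⟨t, ht⟩ := hr j
      rw [← ht]
      refine dist_affMap_le v t _ fun i => ?_
      push_cast
      rw [add_sub_cancel_right]
      exact dist_bary_le v h i
    have hm : ((k : ℝ) - 1) / k ≤ (((k + 1 : ℕ) : ℝ) - 1) / (k + 1 : ℕ) := by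
      push_cast
      rcases Nat.eq_zero_or_pos k with rfl | hk
      · simp
      · have : (0 : ℝ) < k := by exact_mod_cast hk
        rw [div_le_div_iff₀ this (by positivity)]
        nlinarith
    have h0 : 0 ≤ (((k + 1 : ℕ) : ℝ) - 1) / (k + 1 : ℕ) * d := by
      push_cast
      rw [add_sub_cancel_right]
      positivity
    refine of_mem_supp ⟨fun j => ?_, fun j j' => ?_⟩
    · refine Fin.cases ?_ (fun j => ?_) j
      · exact ⟨_, rfl⟩
      · exact hr j
    · refine Fin.cases ?_ (fun j => ?_) j <;> refine Fin.cases ?_ (fun j' => ?_) j'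
      · simpa using h0
      · simpa [dist_comm] using hb j'
      · simpa using hb j
      · exact (hw2 j j').trans (mul_le_mul_of_nonneg_right hm hd)

/-- Iterated subdivision shrinks the mesh as much as desired. -/
lemma sd_iterate_mem_supp (v : Fin (k + 1) → Splx n) {d : ℝ} (hd : 0 ≤ d)
    (h : ∀ i j, dist (v i) (v j) ≤ d) (N : ℕ) :
    (sd n (k + 1))^[N] (of v) ∈ supp {w : Fin (k + 1) → Splx n |
      ∀ i j, dist (w i) (w j) ≤ ((k : ℝ) / (k + 1)) ^ N * d} := by
  induction N with
  | zero => exact of_mem_supp (by simpa using h)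
  | succ N ih =>
    rw [Function.iterate_succ_apply']
    refine map_mem_of_mem_supp ih _ _ fun w hw => ?_
    have := sd_of_mem_supp w (by positivity) hw
    refine Submodule.span_mono (Set.image_mono ?_) this
    rintro u ⟨-, hu⟩ i j
    have := hu i j
    push_cast at this
    rwa [add_sub_cancel_right, ← mul_assoc, ← pow_succ'] at this

end AffChain

/-! ### Quasi-isomorphisms and relative chains -/

section HomologicalAlgebra

variable {C : Type*} [Category* C] [Abelian C] {S₁ S₂ : ShortComplex (ChainComplex C ℕ)}

/-- The five lemma: a morphism of short exact sequences of chain complexes which is a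
quasi-isomorphism on the outer terms is a quasi-isomorphism on the middle term. -/
lemma quasiIso_middle (φ : S₁ ⟶ S₂) (hS₁ : S₁.ShortExact) (hS₂ : S₂.ShortExact)
    (h₁ : QuasiIso φ.τ₁) (h₃ : QuasiIso φ.τ₃) : QuasiIso φ.τ₂ := by
  rw [quasiIso_iff]
  intro i
  rw [quasiIsoAt_iff_isIso_homologyMap]
  have hm : Mono (homologyMap φ.τ₂ i) := by
    apply Abelian.mono_of_epi_of_mono_of_mono
      ((ComposableArrows.δ₀Functor ⋙ ComposableArrows.δ₀Functor).map
        (mapComposableArrows₅ φ hS₁ hS₂ (i + 1) i rfl))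
    · exact (composableArrows₅_exact hS₁ (i + 1) i rfl).δ₀.δ₀
    · exact (composableArrows₅_exact hS₂ (i + 1) i rfl).δ₀.δ₀
    · change Epi (homologyMap φ.τ₃ (i + 1))
      infer_instance
    · change Mono (homologyMap φ.τ₁ i)
      infer_instance
    · change Mono (homologyMap φ.τ₃ i)
      infer_instance
  have he : Epi (homologyMap φ.τ₂ i) := by
    cases i with
    | zero =>
      refine Abelian.epi_of_epi_of_epi_of_epi (mapComposableArrows₂ φ 0)
        (composableArrows₂_exact hS₂ 0) ?_ ?_ ?_
      · have := hS₁.epi_g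
        exact epi_homologyMap_of_epi_of_not_rel S₁.g 0 (by simp)
      · change Epi (homologyMap φ.τ₁ 0)
        infer_instance
      · change Epi (homologyMap φ.τ₃ 0)
        infer_instance
    | succ j =>
      apply Abelian.epi_of_epi_of_epi_of_mono
        ((ComposableArrows.δlastFunctor ⋙ ComposableArrows.δlastFunctor).map
          (mapComposableArrows₅ φ hS₁ hS₂ (j + 1) j rfl))
      · exact (composableArrows₅_exact hS₁ (j + 1) j rfl).δlast.δlast
      · exact (composableArrows₅_exact hS₂ (j + 1) j rfl).δlast.δlast
      · change Epi (homologyMap φ.τ₁ (j + 1))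
        infer_instance
      · change Epi (homologyMap φ.τ₃ (j + 1))
        infer_instance
      · change Mono (homologyMap φ.τ₁ j)
        infer_instance
  exact isIso_of_mono_of_epi _

/-- A monomorphism and its cokernel, as a short complex. -/
noncomputable abbrev cokernelSequence {K L : ChainComplex C ℕ} (φ : K ⟶ L) :
    ShortComplex (ChainComplex C ℕ) :=
  ShortComplex.mk φ (cokernel.π φ) (cokernel.condition φ)

lemma cokernelSequence_shortExact {K L : ChainComplex C ℕ} (φ : K ⟶ L) [Mono φ] :
    (cokernelSequence φ).ShortExact where
  exact := ShortComplex.exact_cokernel φ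

/-- The map induced on cokernels is a quasi-isomorphism if the given maps are. -/
lemma quasiIso_cokernel_map {K L K' L' : ChainComplex C ℕ} (φ : K ⟶ L) (φ' : K' ⟶ L')
    [Mono φ] [Mono φ'] (a : K ⟶ K') (b : L ⟶ L') (w : φ ≫ b = a ≫ φ')
    (ha : QuasiIso a) (hb : QuasiIso b) : QuasiIso (cokernel.map φ φ' a b w) := by
  let ψ : cokernelSequence φ ⟶ cokernelSequence φ' :=
    { τ₁ := a, τ₂ := b, τ₃ := cokernel.map φ φ' a b w
      comm₁₂ := w.symm
      comm₂₃ := (cokernel.π_desc _ _ _).symm }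
  exact quasiIso_τ₃ ψ (cokernelSequence_shortExact φ) (cokernelSequence_shortExact φ') ha hb

lemma quasiIso_of_mono_of_acyclic_cokernel {K L : ChainComplex C ℕ} (φ : K ⟶ L) [Mono φ]
    (h : (cokernel φ).Acyclic) : QuasiIso φ := by
  let S : ShortComplex (ChainComplex C ℕ) := ShortComplex.mk (𝟙 K) (0 : K ⟶ (0 : ChainComplex C ℕ))
    comp_zero
  have hS : S.ShortExact :=
    { exact := by
        rw [ShortComplex.exact_iff_epi _ rfl]
        change Epi (𝟙 K)
        infer_instance
      mono_f := by change Mono (𝟙 K); infer_instance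
      epi_g := by
        exact ⟨fun f g _ => (Limits.isZero_zero (ChainComplex C ℕ)).eq_of_src f g⟩ }
  let ψ : S ⟶ cokernelSequence φ :=
    { τ₁ := 𝟙 K, τ₂ := φ, τ₃ := 0
      comm₁₂ := rfl
      comm₂₃ := by simp [S] }
  refine quasiIso_middle ψ hS (cokernelSequence_shortExact φ) ?_ ?_
  · change QuasiIso (𝟙 K)
    infer_instance
  · rw [quasiIso_iff]
    intro i
    rw [quasiIsoAt_iff_exactAt]
    · exact h i
    · rw [exactAt_iff_isZero_homology]
      exact (homologyFunctor C _ i).map_isZero (Limits.isZero_zero (ChainComplex C ℕ))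

end HomologicalAlgebra

section Modules

variable {K L : ChainComplex (ModuleCat.{0} ℤ) ℕ}

lemma comm_apply (φ : K ⟶ L) (i j : ℕ) (x : K.X i) : L.d i j (φ.f i x) = φ.f j (K.d i j x) := by
  rw [← ModuleCat.comp_apply, ← ModuleCat.comp_apply, φ.comm]

lemma cokernel_π_surjective (φ : K ⟶ L) (k : ℕ) :
    Function.Surjective ((cokernel.π φ).f k) :=
  (ModuleCat.epi_iff_surjective _).1 inferInstance

lemma cokernel_π_apply_eq_zero_iff (φ : K ⟶ L) (k : ℕ) (y : L.X k) :
    (cokernel.π φ).f k y = 0 ↔ ∃ x, φ.f k x = y := by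
  constructor
  · have h := (ShortComplex.exact_cokernel φ).map (eval (ModuleCat.{0} ℤ) (.down ℕ) k)
    rw [ShortComplex.moduleCat_exact_iff] at h
    exact h y
  · rintro ⟨x, rfl⟩
    change (φ ≫ cokernel.π φ).f k x = 0
    rw [cokernel.condition]
    rfl

lemma exactAt_succ_iff (k : ℕ) : L.ExactAt (k + 1) ↔
    ∀ y : L.X (k + 1), L.d (k + 1) k y = 0 → ∃ z, L.d (k + 2) (k + 1) z = y := by
  rw [exactAt_iff' L (k + 2) (k + 1) k (by simp) (by simp), ShortComplex.moduleCat_exact_iff]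
  rfl

lemma exactAt_zero_iff : L.ExactAt 0 ↔ ∀ y : L.X 0, ∃ z, L.d 1 0 z = y := by
  rw [exactAt_iff' L 1 0 0 (by simp) (by simp), ShortComplex.moduleCat_exact_iff]
  refine forall_congr' fun y => ⟨fun h => h ?_, fun h _ => h⟩
  change L.d 0 0 y = 0
  rw [L.shape _ _ (by simp)]
  rfl

/-- A degreewise injective chain map is a quasi-isomorphism if the quotient complex is acyclic;
here the latter condition is spelled out in terms of elements. -/
lemma quasiIso_of_injective (φ : K ⟶ L) (hφ : ∀ k, Function.Injective (φ.f k))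
    (h0 : ∀ y : L.X 0, ∃ x z, y = φ.f 0 x + L.d 1 0 z)
    (h : ∀ (k : ℕ) (y : L.X (k + 1)) (w : K.X k), L.d (k + 1) k y = φ.f k w →
      ∃ x z, y = φ.f (k + 1) x + L.d (k + 2) (k + 1) z) : QuasiIso φ := by
  have : ∀ i, Mono (φ.f i) := fun i => (ModuleCat.mono_iff_injective _).2 (hφ i)
  have : Mono φ := HomologicalComplex.mono_of_mono_f φ this
  refine quasiIso_of_mono_of_acyclic_cokernel φ fun k => ?_
  cases k with
  | zero =>
    rw [exactAt_zero_iff]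
    intro y
    obtain ⟨y, rfl⟩ := cokernel_π_surjective φ 0 y
    obtain ⟨x, z, rfl⟩ := h0 y
    refine ⟨(cokernel.π φ).f 1 z, ?_⟩
    rw [comm_apply, map_add, (cokernel_π_apply_eq_zero_iff φ 0 _).2 ⟨x, rfl⟩, zero_add]
  | succ k =>
    rw [exactAt_succ_iff]
    intro y hy
    obtain ⟨y, rfl⟩ := cokernel_π_surjective φ _ y
    rw [comm_apply, cokernel_π_apply_eq_zero_iff] at hy
    obtain ⟨w, hw⟩ := hy
    obtain ⟨x, z, rfl⟩ := h k y w hw.symm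
    refine ⟨(cokernel.π φ).f (k + 2) z, ?_⟩
    rw [comm_apply, map_add, (cokernel_π_apply_eq_zero_iff φ (k + 1) _).2 ⟨x, rfl⟩, zero_add]

end Modules

section Rel

variable {X Y Z : TopCat.{0}}

/-- The inclusion of a subspace. -/
def subIncl (A : Set X) : TopCat.of A ⟶ X := TopCat.ofHom ⟨Subtype.val, continuous_subtype_val⟩

/-- The restriction of a map to subspaces. -/
def subMap (f : X ⟶ Y) {A : Set X} {B : Set Y} (h : Set.MapsTo f A B) :
    TopCat.of A ⟶ TopCat.of B :=
  TopCat.ofHom ⟨h.restrict, f.hom.continuous.restrict h⟩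

lemma mono_singChains_map (f : X ⟶ Y) (hf : Function.Injective f) : Mono (singChains.map f) :=
  HomologicalComplex.mono_of_mono_f _ fun i =>
    (ModuleCat.mono_iff_injective _).2 (SingChain.map_injective f hf i)

instance (A : Set X) : Mono (singChains.map (subIncl A)) :=
  mono_singChains_map _ Subtype.val_injective

/-- The complex of singular chains of `X` relative to `A`. -/
noncomputable abbrev relChains (A : Set X) : ChainComplex (ModuleCat.{0} ℤ) ℕ :=
  cokernel (singChains.map (subIncl A))

/-- The map on relative chains induced by a map of pairs. -/
noncomputable def relMap (f : X ⟶ Y) {A : Set X} {B : Set Y} (h : Set.MapsTo f A B) :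
    relChains A ⟶ relChains B :=
  cokernel.map _ _ (singChains.map (subMap f h)) (singChains.map f) (by
    rw [← Functor.map_comp, ← Functor.map_comp]
    rfl)

lemma π_relMap (f : X ⟶ Y) {A : Set X} {B : Set Y} (h : Set.MapsTo f A B) :
    cokernel.π _ ≫ relMap f h = singChains.map f ≫ cokernel.π _ :=
  cokernel.π_desc _ _ _

lemma relMap_comp_eq {Y' : TopCat.{0}} (f : X ⟶ Y) (g : Y ⟶ Z) (f' : X ⟶ Y') (g' : Y' ⟶ Z)
    {A : Set X} {B : Set Y} {B' : Set Y'} {D : Set Z} (hf : Set.MapsTo f A B)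
    (hg : Set.MapsTo g B D) (hf' : Set.MapsTo f' A B') (hg' : Set.MapsTo g' B' D)
    (w : f ≫ g = f' ≫ g') : relMap f hf ≫ relMap g hg = relMap f' hf' ≫ relMap g' hg' := by
  rw [← cancel_epi (cokernel.π _), ← Category.assoc, π_relMap, Category.assoc, π_relMap,
    ← Category.assoc, ← Functor.map_comp, w, ← Category.assoc, π_relMap, Category.assoc, π_relMap,
    ← Category.assoc, ← Functor.map_comp]

lemma quasiIso_relMap (f : X ⟶ Y) {A : Set X} {B : Set Y} (h : Set.MapsTo f A B)
    (h1 : QuasiIso (singChains.map (subMap f h))) (h2 : QuasiIso (singChains.map f)) :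
    QuasiIso (relMap f h) :=
  quasiIso_cokernel_map _ _ _ _ (by rw [← Functor.map_comp, ← Functor.map_comp]; rfl) h1 h2

end Rel

/-! ### Barycentric subdivision of singular chains and excision -/

/-- The vertices of the standard simplex, as an affine simplex. -/
noncomputable def stdVert (n : ℕ) : Fin (n + 1) → Splx n := fun i => stdSimplex.vertex i

namespace SingChain

variable {X : TopCat.{0}} {n m k : ℕ}

/-- The singular chain in `X` obtained by composing `σ` with the simplices of an affine chain. -/
noncomputable def real (σ : C(Splx n, X)) : AffChain n (k + 1) →ₗ[ℤ] (singChains.obj X).X k :=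
  AffChain.lift fun v => of (σ.comp (affMap v))

lemma real_of (σ : C(Splx n, X)) (v : Fin (k + 1) → Splx n) :
    real σ (AffChain.of v) = of (σ.comp (affMap v)) := AffChain.lift_of _ _

lemma d_real (σ : C(Splx n, X)) (c : AffChain n (k + 2)) :
    (singChains.obj X).d (k + 1) k (real σ c) = real σ (AffChain.bd n (k + 1) c) := by
  refine LinearMap.congr_fun (f := ((singChains.obj X).d (k + 1) k).hom ∘ₗ real σ)
    (g := real σ ∘ₗ AffChain.bd n (k + 1)) (AffChain.hom_ext fun v => ?_) c
  rw [LinearMap.comp_apply, LinearMap.comp_apply, AffChain.bd_of, map_sum, real_of]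
  refine (d_of _).trans (Finset.sum_congr rfl fun i _ => ?_)
  rw [map_zsmul, real_of]
  congr 2
  ext t
  exact congrArg σ (affMap_map v i.succAbove t)

lemma real_comp (σ : C(Splx n, X)) (w : Fin (m + 1) → Splx n) (c : AffChain m (k + 1)) :
    real (σ.comp (affMap w)) c = real σ (AffChain.map w c) := by
  refine LinearMap.congr_fun (f := real (σ.comp (affMap w))) (g := real σ ∘ₗ AffChain.map w)
    (AffChain.hom_ext fun v => ?_) c
  rw [LinearMap.comp_apply, AffChain.map_of, real_of, real_of]
  congr 1
  ext t
  exact congrArg σ (affMap_affMap w v t)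

lemma comp_affMap_stdVert (σ : C(Splx n, X)) : σ.comp (affMap (stdVert n)) = σ := by
  ext t
  exact congrArg σ (affMap_vertices t)

lemma map_stdVert (w : Fin (m + 1) → Splx n) :
    AffChain.map w (AffChain.of (stdVert m)) = AffChain.of w := by
  rw [AffChain.map_of]
  congr 1
  funext i
  exact affMap_vertex w i

/-- Barycentric subdivision of singular chains. -/
noncomputable def subdiv (X : TopCat.{0}) (k : ℕ) :
    (singChains.obj X).X k →ₗ[ℤ] (singChains.obj X).X k :=
  lift fun σ => real σ (AffChain.sd k (k + 1) (AffChain.of (stdVert k)))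

/-- The homotopy between barycentric subdivision and the identity. -/
noncomputable def subdivHtpy (X : TopCat.{0}) (k : ℕ) :
    (singChains.obj X).X k →ₗ[ℤ] (singChains.obj X).X (k + 1) :=
  lift fun σ => real σ (AffChain.sdHtpy k (k + 1) (AffChain.of (stdVert k)))

lemma subdiv_real (σ : C(Splx n, X)) (c : AffChain n (k + 1)) :
    subdiv X k (real σ c) = real σ (AffChain.sd n (k + 1) c) := by
  refine LinearMap.congr_fun (f := subdiv X k ∘ₗ real σ) (g := real σ ∘ₗ AffChain.sd n (k + 1))
    (AffChain.hom_ext fun v => ?_) c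
  rw [LinearMap.comp_apply, LinearMap.comp_apply, real_of, subdiv, lift_of, real_comp,
    AffChain.map_sd, map_stdVert]

lemma subdivHtpy_real (σ : C(Splx n, X)) (c : AffChain n (k + 1)) :
    subdivHtpy X k (real σ c) = real σ (AffChain.sdHtpy n (k + 1) c) := by
  refine LinearMap.congr_fun (f := subdivHtpy X k ∘ₗ real σ)
    (g := real σ ∘ₗ AffChain.sdHtpy n (k + 1)) (AffChain.hom_ext fun v => ?_) c
  rw [LinearMap.comp_apply, LinearMap.comp_apply, real_of, subdivHtpy, lift_of, real_comp,
    AffChain.map_sdHtpy, map_stdVert]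

lemma of_eq_real (σ : C(Splx n, X)) : of σ = real σ (AffChain.of (stdVert n)) := by
  rw [real_of, comp_affMap_stdVert]

lemma d_subdiv (c : (singChains.obj X).X (k + 1)) :
    (singChains.obj X).d (k + 1) k (subdiv X (k + 1) c) =
      subdiv X k ((singChains.obj X).d (k + 1) k c) := by
  refine LinearMap.congr_fun (f := ((singChains.obj X).d (k + 1) k).hom ∘ₗ subdiv X (k + 1))
    (g := subdiv X k ∘ₗ ((singChains.obj X).d (k + 1) k).hom) (hom_ext fun σ => ?_) c
  rw [LinearMap.comp_apply, LinearMap.comp_apply, of_eq_real, subdiv_real]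
  refine (d_real _ _).trans ?_
  rw [AffChain.bd_sd, ← subdiv_real]
  exact congrArg _ (d_real _ _).symm

lemma d_subdivHtpy (c : (singChains.obj X).X (k + 1)) :
    (singChains.obj X).d (k + 2) (k + 1) (subdivHtpy X (k + 1) c) =
      c - subdiv X (k + 1) c - subdivHtpy X k ((singChains.obj X).d (k + 1) k c) := by
  refine LinearMap.congr_fun
    (f := ((singChains.obj X).d (k + 2) (k + 1)).hom ∘ₗ subdivHtpy X (k + 1))
    (g := LinearMap.id - subdiv X (k + 1) -
      subdivHtpy X k ∘ₗ ((singChains.obj X).d (k + 1) k).hom) (hom_ext fun σ => ?_) c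
  rw [LinearMap.comp_apply, LinearMap.sub_apply, LinearMap.sub_apply, LinearMap.comp_apply,
    of_eq_real, subdivHtpy_real, subdiv_real]
  refine (d_real _ _).trans ?_
  rw [AffChain.bd_sdHtpy, map_sub, map_sub, ← subdivHtpy_real, LinearMap.id_apply]
  congr 2
  exact (d_real _ _).symm

lemma real_mem_supp (σ : C(Splx n, X)) (c : AffChain n (k + 1)) (U : Set X) (h : Set.range σ ⊆ U) :
    real σ c ∈ supp {τ : C(Splx k, X) | Set.range τ ⊆ U} := by
  refine AffChain.map_mem_of_mem_supp (AffChain.mem_supp_univ c) (real σ) _ fun v _ => ?_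
  rw [real_of, supp_eq_span]
  refine Submodule.subset_span ⟨_, ?_, rfl⟩
  rintro _ ⟨t, rfl⟩
  exact h ⟨_, rfl⟩

lemma supp_mono {s t : Set C(Splx n, X)} (h : s ⊆ t) : supp s ≤ supp t := by
  rw [supp_eq_span, supp_eq_span]
  exact Submodule.span_mono (Set.image_mono h)

/-- The chains all of whose simplices lie in `N` or in `V`. -/
noncomputable abbrev small (N V : Set X) (k : ℕ) : Submodule ℤ ((singChains.obj X).X k) :=
  supp {τ : C(Splx k, X) | Set.range τ ⊆ N ∨ Set.range τ ⊆ V}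

variable {N V : Set X}

lemma real_mem_small (σ : C(Splx n, X)) (c : AffChain n (k + 1))
    (h : Set.range σ ⊆ N ∨ Set.range σ ⊆ V) : real σ c ∈ small N V k := by
  rcases h with h | h
  · exact supp_mono (fun τ hτ => Or.inl hτ) (real_mem_supp σ c N h)
  · exact supp_mono (fun τ hτ => Or.inr hτ) (real_mem_supp σ c V h)

lemma subdiv_mem_small {c : (singChains.obj X).X k} (hc : c ∈ small N V k) :
    subdiv X k c ∈ small N V k := by
  rw [small, supp_eq_span] at hc
  have : Submodule.span ℤ (of '' {τ : C(Splx k, X) | Set.range τ ⊆ N ∨ Set.range τ ⊆ V}) ≤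
      (small N V k).comap (subdiv X k) := Submodule.span_le.2 (by
    rintro _ ⟨σ, hσ, rfl⟩
    change subdiv X k (of σ) ∈ small N V k
    rw [subdiv, lift_of]
    exact real_mem_small σ _ hσ)
  exact this hc

lemma subdivHtpy_mem_small {c : (singChains.obj X).X k} (hc : c ∈ small N V k) :
    subdivHtpy X k c ∈ small N V (k + 1) := by
  rw [small, supp_eq_span] at hc
  have : Submodule.span ℤ (of '' {τ : C(Splx k, X) | Set.range τ ⊆ N ∨ Set.range τ ⊆ V}) ≤
      (small N V (k + 1)).comap (subdivHtpy X k) := Submodule.span_le.2 (by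
    rintro _ ⟨σ, hσ, rfl⟩
    change subdivHtpy X k (of σ) ∈ small N V (k + 1)
    rw [subdivHtpy, lift_of]
    exact real_mem_small σ _ hσ)
  exact this hc

/-- After sufficiently many subdivisions, a simplex becomes small with respect to an open cover:
this is the Lebesgue number lemma applied to the preimage of the cover. -/
lemma exists_subdiv_iterate_of_mem_small (hN : IsOpen N) (hV : IsOpen V) (hc : N ∪ V = Set.univ)
    (σ : C(Splx k, X)) : ∃ r, (subdiv X k)^[r] (of σ) ∈ small N V k := by
  obtain ⟨δ, hδ, hball⟩ := lebesgue_number_lemma_of_metric (s := (Set.univ : Set (Splx k)))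
    (c := fun b : Bool => σ ⁻¹' (if b then N else V)) isCompact_univ
    (fun b => by cases b <;> simp [hN.preimage σ.continuous, hV.preimage σ.continuous])
    (fun t _ => by
      have : σ t ∈ N ∪ V := hc ▸ Set.mem_univ _
      rw [Set.mem_iUnion]
      rcases this with h | h
      · exact ⟨true, h⟩
      · exact ⟨false, h⟩)
  have hlim : Filter.Tendsto (fun r : ℕ => ((k : ℝ) / (k + 1)) ^ r * Metric.diam
      (Set.univ : Set (Splx k))) Filter.atTop (nhds (0 * _)) :=
    (tendsto_pow_atTop_nhds_zero_of_lt_one (by positivity)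
      ((div_lt_one (by positivity)).2 (by linarith))).mul_const _
  rw [zero_mul] at hlim
  obtain ⟨r, hr⟩ := (hlim.eventually (gt_mem_nhds hδ)).exists
  refine ⟨r, ?_⟩
  have hmem := AffChain.sd_iterate_mem_supp (stdVert k) Metric.diam_nonneg
    (fun i j => Metric.dist_le_diam_of_mem isCompact_univ.isBounded trivial trivial) r
  have hreal : ∀ c, (subdiv X k)^[r] (real σ c) = real σ ((AffChain.sd k (k + 1))^[r] c) := by
    intro c
    induction r generalizing c with
    | zero => rfl
    | succ r ih =>
      rw [Function.iterate_succ_apply, Function.iterate_succ_apply, subdiv_real]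
      clear hr hmem ih
      induction r generalizing c with
      | zero => rfl
      | succ r ih => rw [Function.iterate_succ_apply, Function.iterate_succ_apply, subdiv_real, ih]
  rw [of_eq_real, hreal]
  refine AffChain.map_mem_of_mem_supp hmem (real σ) _ fun v hv => ?_
  rw [real_of, small, supp_eq_span]
  refine Submodule.subset_span ⟨_, ?_, rfl⟩
  obtain ⟨b, hb⟩ := hball (v 0) trivial
  have key : Set.range (σ.comp (affMap v)) ⊆ if b then N else V := by
    rintro _ ⟨t, rfl⟩
    refine hb ?_
    exact (AffChain.dist_affMap_le v t (v 0) fun i => hv i 0).trans_lt hr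
  cases b
  · exact Or.inr key
  · exact Or.inl key

lemma exists_subdiv_iterate_mem_small (hN : IsOpen N) (hV : IsOpen V) (hc : N ∪ V = Set.univ)
    (c : (singChains.obj X).X k) : ∃ r, (subdiv X k)^[r] c ∈ small N V k := by
  have hmono : ∀ (c : (singChains.obj X).X k) (r s : ℕ), (subdiv X k)^[r] c ∈ small N V k →
      (subdiv X k)^[s + r] c ∈ small N V k := by
    intro c r s h
    induction s with
    | zero => simpa using h
    | succ s ih =>
      rw [Nat.succ_add, Function.iterate_succ_apply']
      exact subdiv_mem_small ih
  have hmem : c ∈ supp (Set.univ : Set C(Splx k, X)) :=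
    (Finsupp.mem_supported ℤ _).2 (Set.subset_univ _)
  rw [supp_eq_span] at hmem
  induction hmem using Submodule.span_induction with
  | mem x hx =>
    obtain ⟨σ, -, rfl⟩ := hx
    exact exists_subdiv_iterate_of_mem_small hN hV hc σ
  | zero => exact ⟨0, Submodule.zero_mem _⟩
  | add x y _ _ hx hy =>
    obtain ⟨r, hr⟩ := hx
    obtain ⟨s, hs⟩ := hy
    refine ⟨s + r, ?_⟩
    rw [iterate_map_add]
    refine Submodule.add_mem _ (hmono _ _ _ hr) ?_
    rw [add_comm]
    exact hmono _ _ _ hs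
  | smul a x _ hx =>
    obtain ⟨r, hr⟩ := hx
    refine ⟨r, ?_⟩
    have e : (subdiv X k)^[r] (a • x) = a • (subdiv X k)^[r] x := by
      rw [← Module.End.pow_apply, ← Module.End.pow_apply]
      exact LinearMap.map_smul _ a x
    exact (congrArg (fun z => z ∈ small N V k) e).mpr (Submodule.smul_mem _ _ hr)

/-- The complex of singular chains modulo small chains is acyclic. -/
lemma exists_sub_d_mem_small (hN : IsOpen N) (hV : IsOpen V) (hc : N ∪ V = Set.univ)
    (c : (singChains.obj X).X (k + 1)) (hdc : (singChains.obj X).d (k + 1) k c ∈ small N V k) :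
    ∃ e, c - (singChains.obj X).d (k + 2) (k + 1) e ∈ small N V (k + 1) := by
  obtain ⟨r, hr⟩ := exists_subdiv_iterate_mem_small hN hV hc c
  induction r generalizing c with
  | zero => exact ⟨0, by simpa using hr⟩
  | succ r ih =>
    rw [Function.iterate_succ_apply] at hr
    obtain ⟨e, he⟩ := ih (subdiv X (k + 1) c) (by rw [d_subdiv]; exact subdiv_mem_small hdc) hr
    refine ⟨e + subdivHtpy X (k + 1) c, ?_⟩
    rw [map_add, d_subdivHtpy]
    have := Submodule.add_mem _ he (subdivHtpy_mem_small hdc)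
    convert this using 1
    abel

lemma range_map_subIncl (A : Set X) :
    LinearMap.range ((singChains.map (subIncl A)).f k).hom =
      supp {τ : C(Splx k, X) | Set.range τ ⊆ A} := by
  rw [range_map]
  congr 1
  ext τ
  constructor
  · rintro ⟨σ, rfl⟩ _ ⟨t, rfl⟩
    exact (σ t).2
  · intro h
    exact ⟨⟨fun t => ⟨τ t, h ⟨t, rfl⟩⟩, τ.continuous.subtype_mk _⟩, rfl⟩

lemma mem_small_iff (c : (singChains.obj X).X k) : c ∈ small N V k ↔
    ∃ a b, c = (singChains.map (subIncl N)).f k a + (singChains.map (subIncl V)).f k b := by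
  have : small N V k = LinearMap.range ((singChains.map (subIncl N)).f k).hom ⊔
      LinearMap.range ((singChains.map (subIncl V)).f k).hom := by
    rw [range_map_subIncl, range_map_subIncl, small, supp_eq_span, supp_eq_span, supp_eq_span,
      ← Submodule.span_union, ← Set.image_union]
    rfl
  rw [this, Submodule.mem_sup]
  constructor
  · rintro ⟨_, ⟨a, rfl⟩, _, ⟨b, rfl⟩, h⟩
    exact ⟨a, b, h.symm⟩
  · rintro ⟨a, b, h⟩
    exact ⟨_, ⟨a, rfl⟩, _, ⟨b, rfl⟩, h.symm⟩

/-- A chain in `V` which lies in `N` as a chain in `X` lies in `V ∩ N`. -/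
lemma exists_map_eq_of_map_eq (c : (singChains.obj (TopCat.of V)).X k)
    (a : (singChains.obj (TopCat.of N)).X k)
    (h : (singChains.map (subIncl N)).f k a = (singChains.map (subIncl V)).f k c) :
    ∃ b, (singChains.map (subIncl (X := TopCat.of V) (Subtype.val ⁻¹' N))).f k b = c := by
  have h1 : (singChains.map (subIncl V)).f k c ∈ supp {τ : C(Splx k, X) | Set.range τ ⊆ N} := by
    rw [← range_map_subIncl]
    exact ⟨a, h⟩
  have h2 : c ∈ supp {τ : C(Splx k, TopCat.of V) | Set.range τ ⊆ Subtype.val ⁻¹' N} := by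
    refine (Finsupp.mem_supported ℤ _).2 fun σ hσ => ?_
    have h3 := (Finsupp.mem_supported ℤ _).1 h1
    have h4 : (subIncl V).hom.comp σ ∈ {τ : C(Splx k, X) | Set.range τ ⊆ N} := by
      refine h3 ?_
      classical
      have := Finsupp.mapDomain_support_of_injective (M := ℤ)
        (f := fun σ : C(Splx k, TopCat.of V) => (subIncl V).hom.comp σ) (fun σ τ h => by
          ext t
          exact DFunLike.congr_fun h t) c
      have h5 : (subIncl V).hom.comp σ ∈ (Finsupp.mapDomain (fun σ : C(Splx k, TopCat.of V) =>
        (subIncl V).hom.comp σ) (c : C(Splx k, TopCat.of V) →₀ ℤ)).support := by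
        rw [this]
        exact Finset.mem_image_of_mem _ hσ
      exact h5
    rintro _ ⟨t, rfl⟩
    exact h4 ⟨t, rfl⟩
  rw [← range_map_subIncl] at h2
  exact h2

end SingChain

open SingChain

/-- Excision: if `N` and `V` form an open cover of `X`, then the chains of `V` relative to `V ∩ N`
compute the homology of `X` relative to `N`. -/
theorem quasiIso_excision {X : TopCat.{0}} (N V : Set X) (hN : IsOpen N) (hV : IsOpen V)
    (hc : N ∪ V = Set.univ) :
    QuasiIso (relMap (subIncl V) (A := Subtype.val ⁻¹' N) (B := N) (fun _ h => h)) := by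
  set φ := relMap (subIncl V) (A := Subtype.val ⁻¹' N) (B := N) (fun _ h => h) with hφ
  have hπ : ∀ (k : ℕ) (c : (singChains.obj (TopCat.of V)).X k),
      φ.f k ((cokernel.π (singChains.map (subIncl (X := TopCat.of V) (Subtype.val ⁻¹' N)))).f k c) =
        (cokernel.π (singChains.map (subIncl N))).f k ((singChains.map (subIncl V)).f k c) := by
    intro k c
    have := congrArg (fun f => f.f k) (π_relMap (subIncl V) (A := Subtype.val ⁻¹' N) (B := N)
      (fun _ h => h))
    exact congrArg (fun f => f.hom c) this
  have hN0 : ∀ (k : ℕ) (a : (singChains.obj (TopCat.of N)).X k),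
      (cokernel.π (singChains.map (subIncl N))).f k ((singChains.map (subIncl N)).f k a) = 0 :=
    fun k a => (cokernel_π_apply_eq_zero_iff _ _ _).2 ⟨a, rfl⟩
  refine quasiIso_of_injective φ (fun k => ?_) (fun y => ?_) (fun k y w hyw => ?_)
  · rw [injective_iff_map_eq_zero]
    intro x hx
    obtain ⟨c, rfl⟩ := cokernel_π_surjective _ k x
    rw [hπ, cokernel_π_apply_eq_zero_iff] at hx
    obtain ⟨a, ha⟩ := hx
    rw [cokernel_π_apply_eq_zero_iff]
    exact exists_map_eq_of_map_eq c a ha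
  · obtain ⟨c, rfl⟩ := cokernel_π_surjective _ 0 y
    obtain ⟨a, b, rfl⟩ := (mem_small_iff (N := N) (V := V) c).1 (by
      refine (Finsupp.mem_supported ℤ _).2 fun (σ : C(Splx 0, X)) _ => ?_
      have : σ default ∈ N ∪ V := hc ▸ Set.mem_univ _
      refine this.imp ?_ ?_ <;>
      · rintro h _ ⟨t, rfl⟩
        rwa [Subsingleton.elim t default])
    refine ⟨(cokernel.π (singChains.map (subIncl _))).f 0 b, 0, ?_⟩
    rw [hπ, map_add, hN0, zero_add, map_zero, add_zero]
  · obtain ⟨c, rfl⟩ := cokernel_π_surjective _ _ y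
    obtain ⟨b, rfl⟩ := cokernel_π_surjective _ _ w
    rw [hπ, comm_apply, ← sub_eq_zero, ← map_sub, cokernel_π_apply_eq_zero_iff] at hyw
    obtain ⟨a, ha⟩ := hyw
    obtain ⟨e, he⟩ := exists_sub_d_mem_small hN hV hc c
      ((mem_small_iff _).2 ⟨a, b, by rw [ha]; abel⟩)
    obtain ⟨a', b', hab⟩ := (mem_small_iff _).1 he
    refine ⟨(cokernel.π (singChains.map (subIncl _))).f (k + 1) b',
      (cokernel.π (singChains.map (subIncl N))).f (k + 2) e, ?_⟩
    rw [hπ, comm_apply, sub_eq_iff_eq_add.1 hab, map_add, map_add, hN0, zero_add]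

/-! ### Homotopy invariance and the attaching of cells -/

/-- A section of a retraction which is homotopic to the identity induces a quasi-isomorphism. -/
lemma quasiIso_of_deformation {A X : TopCat.{0}} (i : A ⟶ X) (r : X ⟶ A) (h : i ≫ r = 𝟙 A)
    (H : TopCat.Homotopy (𝟙 X) (r ≫ i)) : QuasiIso (singChains.map i) := by
  let R := ModuleCat.of ℤ ℤ
  let S := (AlgebraicTopology.singularChainComplexFunctor (ModuleCat.{0} ℤ)).obj R
  let e : HomotopyEquiv (S.obj A) (S.obj X) :=
    { hom := S.map i
      inv := S.map r
      homotopyHomInvId := Homotopy.ofEq (by rw [← S.map_comp, h, S.map_id])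
      homotopyInvHomId := (Homotopy.ofEq (by rw [← S.map_comp])).trans
        ((H.singularChainComplexFunctorObjMap R).symm.trans (Homotopy.ofEq (S.map_id X))) }
  have h1 : QuasiIso (S.map i) := e.quasiIso_hom
  have h2 : singChains.map i = singChainsIso.inv.app A ≫ S.map i ≫ singChainsIso.hom.app X := by
    rw [singChainsIso.hom.naturality, Iso.inv_hom_id_app_assoc]
  rw [h2]
  infer_instance

/-- If a neighbourhood `N` of `A` can be deformed into `A` through a homotopy of the whole space,
then homology relative to `A` is homology relative to `N`. -/
lemma quasiIso_relMap_id {X : TopCat.{0}} {A N : Set X} (hAN : A ⊆ N) (G : C(X × unitInterval, X))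
    (h0 : ∀ x, G (x, 0) = x) (hA : ∀ a ∈ A, ∀ s, G (a, s) = a) (hN : ∀ x ∈ N, ∀ s, G (x, s) ∈ N)
    (h1 : ∀ x ∈ N, G (x, 1) ∈ A) : QuasiIso (relMap (𝟙 X) (A := A) (B := N) hAN) := by
  refine quasiIso_relMap _ _ ?_ ?_
  · let r : TopCat.of N ⟶ TopCat.of A :=
      TopCat.ofHom ⟨fun x => ⟨G (x, 1), h1 x x.2⟩, by fun_prop⟩
    refine quasiIso_of_deformation _ r ?_ ?_
    · exact TopCat.hom_ext (ContinuousMap.ext fun a => Subtype.ext (hA a a.2 1))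
    · exact
        { toFun := fun p => ⟨G (p.2, p.1), hN p.2 p.2.2 p.1⟩
          continuous_toFun := by fun_prop
          map_zero_left := fun x => Subtype.ext (h0 x)
          map_one_left := fun x => rfl }
  · rw [CategoryTheory.Functor.map_id]
    infer_instance

lemma quasiIso_of_isHomeomorph {X Y : TopCat.{0}} (f : X ⟶ Y) (hf : IsHomeomorph f) :
    QuasiIso (singChains.map f) := by
  have : IsIso f := (TopCat.isoOfHomeo (hf.homeomorph f)).isIso_hom
  infer_instance

lemma quasiIso_relMap_of_isHomeomorph {X Y : TopCat.{0}} (f : X ⟶ Y) (hf : IsHomeomorph f)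
    {A : Set X} {B : Set Y} (hAB : ∀ x, x ∈ A ↔ f x ∈ B) :
    QuasiIso (relMap f (A := A) (B := B) fun x hx => (hAB x).1 hx) := by
  refine quasiIso_relMap _ _ (quasiIso_of_isHomeomorph _ ?_) (quasiIso_of_isHomeomorph f hf)
  exact ((hf.homeomorph f).subtype hAB).isHomeomorph

/-- `IsAttaching f B A` says that `X` arises from its subspace `A` by gluing `P` to it along the
restriction `B → A` of `f`: the preimage of `A` is `B`, the rest of `P` maps bijectively onto the
rest of `X`, and `X` carries the quotient topology. -/
structure IsAttaching {P X : Type} [TopologicalSpace P] [TopologicalSpace X] (f : P → X)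
    (B : Set P) (A : Set X) : Prop where
  continuous : Continuous f
  isClosed : IsClosed B
  preimage : f ⁻¹' A = B
  injOn : Set.InjOn f Bᶜ
  exists_eq : ∀ x ∉ A, ∃ p, f p = x
  isClosed_of : ∀ Z : Set X, IsClosed (Subtype.val ⁻¹' Z : Set A) → IsClosed (f ⁻¹' Z) → IsClosed Z

/-- `IsCollared B` says that some open neighbourhood of `B` can be pushed into `B` by a homotopy of
the whole space that leaves `B` pointwise fixed. -/
def IsCollared {P : Type} [TopologicalSpace P] (B : Set P) : Prop :=
  ∃ (N : Set P) (H : C(P × unitInterval, P)), IsOpen N ∧ B ⊆ N ∧ (∀ x, H (x, 0) = x) ∧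
    (∀ b ∈ B, ∀ s, H (b, s) = b) ∧ (∀ x ∈ N, ∀ s, H (x, s) ∈ N) ∧ ∀ x ∈ N, H (x, 1) ∈ B

namespace IsAttaching

variable {P X : Type} [TopologicalSpace P] [TopologicalSpace X] {f : P → X} {B : Set P} {A : Set X}

lemma mapsTo (h : IsAttaching f B A) : Set.MapsTo f B A := fun _ hp => h.preimage.ge hp

lemma notMem (h : IsAttaching f B A) {p : P} (hp : p ∉ B) : f p ∉ A :=
  fun h' => hp (h.preimage.le h')

lemma isQuotientMap (h : IsAttaching f B A) :
    IsQuotientMap (Sum.elim (Subtype.val : A → X) f) := by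
  rw [isQuotientMap_iff_isClosed]
  refine ⟨fun x => ?_, fun Z => ⟨fun hZ => hZ.preimage ?_, fun hZ => ?_⟩⟩
  · by_cases hx : x ∈ A
    · exact ⟨Sum.inl ⟨x, hx⟩, rfl⟩
    · obtain ⟨p, hp⟩ := h.exists_eq x hx
      exact ⟨Sum.inr p, hp⟩
  · exact continuous_subtype_val.sumElim h.continuous
  · rw [isClosed_sum_iff] at hZ
    exact h.isClosed_of Z hZ.1 hZ.2

/-- A homotopy of `P` which fixes `B` descends to `X`. -/
lemma exists_homotopy (h : IsAttaching f B A) (H : C(P × unitInterval, P))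
    (hB : ∀ b ∈ B, ∀ s, H (b, s) = b) :
    ∃ G : C(X × unitInterval, X), (∀ a ∈ A, ∀ s, G (a, s) = a) ∧
      ∀ p s, G (f p, s) = f (H (p, s)) := by
  classical
  let g : X × unitInterval → X := fun x =>
    if hx : x.1 ∈ A then x.1 else f (H ((h.exists_eq x.1 hx).choose, x.2))
  have hgA : ∀ a ∈ A, ∀ s, g (a, s) = a := fun a ha s => dif_pos ha
  have hgf : ∀ p s, g (f p, s) = f (H (p, s)) := by
    intro p s
    by_cases hp : p ∈ B
    · rw [hgA _ (h.mapsTo hp), hB p hp]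
    · have hx := h.notMem hp
      have hc := (h.exists_eq (f p) hx).choose_spec
      have hc' : (h.exists_eq (f p) hx).choose = p := by
        refine h.injOn (fun hB' => hx ?_) hp hc
        rw [← hc]
        exact h.mapsTo hB'
      simp only [g, dif_neg hx, hc']
  refine ⟨⟨g, h.isQuotientMap.continuous_lift_prod_left ?_⟩, hgA, hgf⟩
  rw [← (Homeomorph.sumProdDistrib (X := A) (Y := P) (Z := unitInterval)).symm.comp_continuous_iff',
    continuous_sum_dom]
  constructor
  · refine (continuous_subtype_val.comp continuous_fst).congr fun x => ?_
    exact (hgA x.1 x.1.2 x.2).symm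
  · refine (h.continuous.comp H.continuous).congr fun x => ?_
    exact (hgf x.1 x.2).symm

lemma isOpen_of (h : IsAttaching f B A) (U : Set X) (hA : IsOpen (Subtype.val ⁻¹' U : Set A))
    (hP : IsOpen (f ⁻¹' U)) : IsOpen U := by
  rw [← isClosed_compl_iff]
  exact h.isClosed_of _ (by rwa [Set.preimage_compl, isClosed_compl_iff])
    (by rwa [Set.preimage_compl, isClosed_compl_iff])

lemma isClosed_right (h : IsAttaching f B A) : IsClosed A :=
  h.isClosed_of A (by simp) (by rw [h.preimage]; exact h.isClosed)

/-- Outside the subspaces, an attaching map is a homeomorphism. -/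
lemma isHomeomorph_compl (h : IsAttaching f B A) :
    IsHomeomorph (Set.MapsTo.restrict f Bᶜ Aᶜ fun _ hp => h.notMem hp) := by
  refine ⟨h.continuous.restrict _, fun O hO => ?_, fun p q hpq => ?_, fun x => ?_⟩
  · have hO' : IsOpen (Subtype.val '' O) :=
      h.isClosed.isOpen_compl.isOpenMap_subtype_val O hO
    have : IsOpen (f '' (Subtype.val '' O)) := by
      refine h.isOpen_of _ ?_ ?_
      · convert isOpen_empty
        rw [Set.eq_empty_iff_forall_notMem]
        rintro x ⟨_, ⟨p, -, rfl⟩, hx⟩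
        exact h.notMem p.2 (hx ▸ x.2)
      · convert hO'
        ext p
        constructor
        · rintro ⟨_, ⟨q, hq, rfl⟩, hqp⟩
          have : p ∉ B := fun hp => h.notMem q.2 (hqp ▸ h.mapsTo hp)
          exact ⟨q, hq, h.injOn q.2 this hqp⟩
        · exact fun hp => ⟨p, hp, rfl⟩
    convert this.preimage continuous_subtype_val
    ext x
    constructor
    · rintro ⟨p, hp, rfl⟩
      exact ⟨p, ⟨p, hp, rfl⟩, rfl⟩
    · rintro ⟨_, ⟨p, hp, rfl⟩, hx⟩
      exact ⟨p, hp, Subtype.ext hx⟩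
  · exact Subtype.ext (h.injOn p.2 q.2 (congrArg Subtype.val hpq))
  · obtain ⟨p, hp⟩ := h.exists_eq x.1 x.2
    exact ⟨⟨p, fun hB => x.2 (hp ▸ h.mapsTo hB)⟩, Subtype.ext hp⟩

/-- The relative homology of a pair does not change when the pair is glued to another space along
a collared subspace. -/
theorem quasiIso_relMap (h : IsAttaching f B A) (hB : IsCollared B) :
    QuasiIso (relMap (X := TopCat.of P) (Y := TopCat.of X) (TopCat.ofHom ⟨f, h.continuous⟩)
      h.mapsTo) := by
  obtain ⟨N, H, hNo, hBN, H0, HB, HN, H1⟩ := hB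
  obtain ⟨G, GA, Gf⟩ := h.exists_homotopy H HB
  set F : TopCat.of P ⟶ TopCat.of X := TopCat.ofHom ⟨f, h.continuous⟩ with hF
  let N' : Set X := A ∪ f '' N
  have hN' : ∀ p, p ∈ N ↔ f p ∈ N' := by
    refine fun p => ⟨fun hp => Or.inr ⟨p, hp, rfl⟩, ?_⟩
    rintro (hp | ⟨n, hn, hnp⟩)
    · exact hBN (h.preimage.le hp)
    · by_cases hp : p ∈ B
      · exact hBN hp
      · have : n ∉ B := fun hn => h.notMem hp (hnp ▸ h.mapsTo hn)
        exact h.injOn this hp hnp ▸ hn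
  have hN'o : IsOpen N' := by
    refine h.isOpen_of _ ?_ ?_
    · convert isOpen_univ
      ext x
      exact iff_of_true (Or.inl x.2) trivial
    · convert hNo
      ext p
      exact (hN' p).symm
  have q1 : QuasiIso (relMap (𝟙 (TopCat.of P)) (A := B) (B := N) hBN) :=
    quasiIso_relMap_id hBN H H0 HB HN H1
  have q2 : QuasiIso (relMap (𝟙 (TopCat.of X)) (A := A) (B := N') fun _ => Or.inl) := by
    refine quasiIso_relMap_id _ G (fun x => ?_) GA ?_ ?_
    · by_cases hx : x ∈ A
      · exact GA x hx 0
      · obtain ⟨p, rfl⟩ := h.exists_eq x hx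
        exact (Gf p 0).trans (congrArg f (H0 p))
    · rintro _ (hx | ⟨n, hn, rfl⟩) s
      · exact (GA _ hx s).symm ▸ Or.inl hx
      · exact (Gf n s).symm ▸ Or.inr ⟨_, HN n hn s, rfl⟩
    · rintro _ (hx | ⟨n, hn, rfl⟩)
      · exact (GA _ hx 1).symm ▸ hx
      · exact (Gf n 1).symm ▸ h.mapsTo (H1 n hn)
  have hmN : Set.MapsTo F N N' := fun p hp => (hN' p).1 hp
  have q3 : QuasiIso (relMap F hmN) := by
    have e1 := quasiIso_excision (X := TopCat.of P) N Bᶜ hNo h.isClosed.isOpen_compl (by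
      rw [← Set.compl_subset_iff_union]
      exact Set.compl_subset_compl.2 hBN)
    have e2 := quasiIso_excision (X := TopCat.of X) N' Aᶜ hN'o h.isClosed_right.isOpen_compl (by
      rw [← Set.compl_subset_iff_union]
      exact Set.compl_subset_compl.2 fun _ => Or.inl)
    have hc : Set.MapsTo F Bᶜ Aᶜ := fun _ hp => h.notMem hp
    have e3 := quasiIso_relMap_of_isHomeomorph (subMap F hc) h.isHomeomorph_compl
      (A := Subtype.val ⁻¹' N) (B := Subtype.val ⁻¹' N') (fun p => hN' p)
    have e4 : relMap (subIncl (X := TopCat.of P) Bᶜ) (A := Subtype.val ⁻¹' N) (B := N)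
        (fun _ h => h) ≫ relMap F hmN =
        relMap (subMap F hc) (A := Subtype.val ⁻¹' N) (B := Subtype.val ⁻¹' N')
          (fun p => (hN' p).1) ≫
        relMap (subIncl (X := TopCat.of X) Aᶜ) (A := Subtype.val ⁻¹' N') (B := N')
          (fun _ h => h) := relMap_comp_eq _ _ _ _ _ _ _ _ rfl
    have e5 := quasiIso_comp (relMap (subMap F hc) (A := Subtype.val ⁻¹' N)
      (B := Subtype.val ⁻¹' N') (fun p => (hN' p).1)) (relMap (subIncl (X := TopCat.of X) Aᶜ)
        (A := Subtype.val ⁻¹' N') (B := N') (fun _ h => h))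
    rw [← e4] at e5
    exact quasiIso_of_comp_left (relMap (subIncl (X := TopCat.of P) Bᶜ)
      (A := Subtype.val ⁻¹' N) (B := N) (fun _ h => h)) _
  have e6 : relMap F h.mapsTo ≫ relMap (𝟙 (TopCat.of X)) (A := A) (B := N') (fun _ => Or.inl) =
      relMap (𝟙 (TopCat.of P)) (A := B) (B := N) hBN ≫ relMap F hmN :=
    relMap_comp_eq _ _ _ _ _ _ _ _ rfl
  have e7 := quasiIso_comp (relMap (𝟙 (TopCat.of P)) (A := B) (B := N) hBN) (relMap F hmN)
  rw [← e6] at e7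
  exact quasiIso_of_comp_right _ (relMap (𝟙 (TopCat.of X)) (A := A) (B := N') fun _ => Or.inl)

end IsAttaching

/-! ### Three-term chain complexes -/

/-- The modules of a three-term complex; they vanish in degrees greater than two. -/
noncomputable def tripleX (M₂ M₁ M₀ : ModuleCat.{0} ℤ) : ℕ → ModuleCat.{0} ℤ
  | 0 => M₀
  | 1 => M₁
  | 2 => M₂
  | _ + 3 => ModuleCat.of ℤ PUnit

/-- The differentials of a three-term complex. -/
noncomputable def tripleD {M₂ M₁ M₀ : ModuleCat.{0} ℤ} (f : M₂ ⟶ M₁) (g : M₁ ⟶ M₀) :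
    ∀ k, tripleX M₂ M₁ M₀ (k + 1) ⟶ tripleX M₂ M₁ M₀ k
  | 0 => g
  | 1 => f
  | _ + 2 => 0

/-- The chain complex `⋯ → 0 → M₂ → M₁ → M₀`. -/
noncomputable def triple {M₂ M₁ M₀ : ModuleCat.{0} ℤ} (f : M₂ ⟶ M₁) (g : M₁ ⟶ M₀)
    (w : f ≫ g = 0) : ChainComplex (ModuleCat.{0} ℤ) ℕ :=
  ChainComplex.of (tripleX M₂ M₁ M₀) (tripleD f g) fun k => by
    match k with
    | 0 => exact w
    | 1 => exact zero_comp
    | _ + 2 => exact zero_comp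

namespace triple

variable {M₂ M₁ M₀ : ModuleCat.{0} ℤ} {f : M₂ ⟶ M₁} {g : M₁ ⟶ M₀} {w : f ≫ g = 0}

lemma d_eq (k : ℕ) : (triple f g w).d (k + 1) k = tripleD f g k := ChainComplex.of_d _ _ _

/-- The components of a morphism from a three-term complex. -/
noncomputable def homF {L : ℕ → ModuleCat.{0} ℤ} (x : M₂ ⟶ L 2) (y : M₁ ⟶ L 1) (z : M₀ ⟶ L 0) :
    ∀ k, tripleX M₂ M₁ M₀ k ⟶ L k
  | 0 => z
  | 1 => y
  | 2 => x
  | _ + 3 => 0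

/-- A morphism from a three-term complex is given by its three components. -/
noncomputable def hom {L : ChainComplex (ModuleCat.{0} ℤ) ℕ} (x : M₂ ⟶ L.X 2) (y : M₁ ⟶ L.X 1)
    (z : M₀ ⟶ L.X 0) (hx : x ≫ L.d 2 1 = f ≫ y) (hy : y ≫ L.d 1 0 = g ≫ z) :
    triple f g w ⟶ L where
  f := homF x y z
  comm' := by
    rintro _ k rfl
    rw [d_eq]
    match k with
    | 0 => exact hy
    | 1 => exact hx
    | k + 2 => exact zero_comp.trans zero_comp.symm

lemma hom_ext {L : ChainComplex (ModuleCat.{0} ℤ) ℕ} {φ ψ : triple f g w ⟶ L}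
    (h₂ : φ.f 2 = ψ.f 2) (h₁ : φ.f 1 = ψ.f 1) (h₀ : φ.f 0 = ψ.f 0) : φ = ψ := by
  ext k : 1
  match k with
  | 0 => exact h₀
  | 1 => exact h₁
  | 2 => exact h₂
  | k + 3 =>
    apply ModuleCat.hom_ext
    ext x
    have hx : x = 0 := Subsingleton.elim (α := PUnit) _ _
    rw [hx, map_zero, map_zero]

end triple

lemma shortExact_of_elements (S : ShortComplex (ChainComplex (ModuleCat.{0} ℤ) ℕ))
    (hf : ∀ k, Function.Injective (S.f.f k)) (hg : ∀ k, Function.Surjective (S.g.f k))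
    (h : ∀ k (y : S.X₂.X k), S.g.f k y = 0 → ∃ x, S.f.f k x = y) : S.ShortExact := by
  refine shortExact_of_degreewise_shortExact S fun k => ?_
  exact
    { exact := (ShortComplex.moduleCat_exact_iff _).2 (h k)
      mono_f := (ModuleCat.mono_iff_injective _).2 (hf k)
      epi_g := (ModuleCat.epi_iff_surjective _).2 (hg k) }

section Filtration

/-- The zero module. -/
noncomputable abbrev zeroMod : ModuleCat.{0} ℤ := ModuleCat.of ℤ PUnit

variable {M₂ M₁ M₀ : ModuleCat.{0} ℤ}

/-- The three-term complex concentrated in degree zero. -/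
noncomputable abbrev triple₀ (M₀ : ModuleCat.{0} ℤ) : ChainComplex (ModuleCat.{0} ℤ) ℕ :=
  triple (0 : zeroMod ⟶ zeroMod) (0 : zeroMod ⟶ M₀) zero_comp

/-- The three-term complex concentrated in degree one. -/
noncomputable abbrev triple₁ (M₁ : ModuleCat.{0} ℤ) : ChainComplex (ModuleCat.{0} ℤ) ℕ :=
  triple (0 : zeroMod ⟶ M₁) (0 : M₁ ⟶ zeroMod) zero_comp

/-- The three-term complex concentrated in degree two. -/
noncomputable abbrev triple₂ (M₂ : ModuleCat.{0} ℤ) : ChainComplex (ModuleCat.{0} ℤ) ℕ :=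
  triple (0 : M₂ ⟶ zeroMod) (0 : zeroMod ⟶ zeroMod) zero_comp

/-- A three-term complex which vanishes in degree two. -/
noncomputable abbrev triple₀₁ (g : M₁ ⟶ M₀) : ChainComplex (ModuleCat.{0} ℤ) ℕ :=
  triple (0 : zeroMod ⟶ M₁) g zero_comp

/-- A morphism from a complex concentrated in degree zero is given by its component there. -/
noncomputable abbrev triple₀.hom {L : ChainComplex (ModuleCat.{0} ℤ) ℕ} (z : M₀ ⟶ L.X 0) :
    triple₀ M₀ ⟶ L :=
  triple.hom 0 0 z (zero_comp.trans zero_comp.symm) (zero_comp.trans zero_comp.symm)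

/-- A morphism from a complex concentrated in degree one is given by a map to the cycles. -/
noncomputable abbrev triple₁.hom {L : ChainComplex (ModuleCat.{0} ℤ) ℕ} (y : M₁ ⟶ L.X 1)
    (hy : y ≫ L.d 1 0 = 0) : triple₁ M₁ ⟶ L :=
  triple.hom 0 y 0 (zero_comp.trans zero_comp.symm) (by rw [hy, zero_comp])

/-- A morphism from a complex concentrated in degree two is given by a map to the cycles. -/
noncomputable abbrev triple₂.hom {L : ChainComplex (ModuleCat.{0} ℤ) ℕ} (x : M₂ ⟶ L.X 2)
    (hx : x ≫ L.d 2 1 = 0) : triple₂ M₂ ⟶ L :=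
  triple.hom x 0 0 (by rw [hx, zero_comp]) (zero_comp.trans zero_comp.symm)

/-- A morphism from a complex which vanishes in degree two is given by two components. -/
noncomputable abbrev triple₀₁.hom {L : ChainComplex (ModuleCat.{0} ℤ) ℕ} {g : M₁ ⟶ M₀}
    (y : M₁ ⟶ L.X 1) (z : M₀ ⟶ L.X 0) (hy : y ≫ L.d 1 0 = g ≫ z) : triple₀₁ g ⟶ L :=
  triple.hom 0 y z (zero_comp.trans zero_comp.symm) hy

/-- The filtration of a two-term complex by degree. -/
noncomputable abbrev filtration₁ (g : M₁ ⟶ M₀) :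
    ShortComplex (ChainComplex (ModuleCat.{0} ℤ) ℕ) :=
  ShortComplex.mk
    (triple₀.hom (𝟙 M₀) : triple₀ M₀ ⟶ triple₀₁ g)
    (triple.hom 0 (𝟙 M₁) 0 (zero_comp.trans zero_comp.symm)
      (by rw [comp_zero, triple.d_eq]; exact comp_zero) : triple₀₁ g ⟶ triple₁ M₁)
    (triple.hom_ext zero_comp zero_comp comp_zero)

lemma subsingleton_tripleX (M₂ M₁ M₀ : ModuleCat.{0} ℤ) (k : ℕ) :
    Subsingleton (tripleX M₂ M₁ M₀ (k + 3)) :=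
  inferInstanceAs (Subsingleton PUnit)

lemma filtration₁_shortExact (g : M₁ ⟶ M₀) : (filtration₁ g).ShortExact := by
  have hs := fun k => subsingleton_tripleX zeroMod M₁ M₀ k
  refine shortExact_of_elements _ (fun k => ?_) (fun k => ?_) fun k y hy => ?_
  · match k with
    | 0 => exact fun _ _ h => h
    | 1 => exact fun _ _ _ => Subsingleton.elim (α := PUnit) _ _
    | 2 => exact fun _ _ _ => Subsingleton.elim (α := PUnit) _ _
    | k + 3 => exact fun _ _ _ => Subsingleton.elim (α := PUnit) _ _
  · match k with
    | 0 => exact fun _ => ⟨0, Subsingleton.elim (α := PUnit) _ _⟩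
    | 1 => exact fun y => ⟨y, rfl⟩
    | 2 => exact fun _ => ⟨0, Subsingleton.elim (α := PUnit) _ _⟩
    | k + 3 => exact fun _ => ⟨0, Subsingleton.elim (α := PUnit) _ _⟩
  · match k with
    | 0 => exact ⟨y, rfl⟩
    | 1 => exact ⟨0, (map_zero _).trans hy.symm⟩
    | 2 => exact ⟨0, Subsingleton.elim (α := PUnit) _ _⟩
    | k + 3 => exact ⟨0, Subsingleton.elim (α := PUnit) _ _⟩

/-- The filtration of a three-term complex whose quotient is the degree two part. -/
noncomputable abbrev filtration₂ (f : M₂ ⟶ M₁) (g : M₁ ⟶ M₀) (w : f ≫ g = 0) :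
    ShortComplex (ChainComplex (ModuleCat.{0} ℤ) ℕ) :=
  ShortComplex.mk
    (triple₀₁.hom (𝟙 M₁) (𝟙 M₀) (by
      rw [triple.d_eq]; exact (Category.id_comp g).trans (Category.comp_id g).symm) :
      triple₀₁ g ⟶ triple f g w)
    (triple.hom (𝟙 M₂) 0 0 (by rw [comp_zero, triple.d_eq]; exact comp_zero)
      (zero_comp.trans comp_zero.symm) : triple f g w ⟶ triple₂ M₂)
    (triple.hom_ext zero_comp comp_zero comp_zero)

lemma filtration₂_shortExact (f : M₂ ⟶ M₁) (g : M₁ ⟶ M₀) (w : f ≫ g = 0) :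
    (filtration₂ f g w).ShortExact := by
  refine shortExact_of_elements _ (fun k => ?_) (fun k => ?_) fun k y hy => ?_
  · match k with
    | 0 => exact fun _ _ h => h
    | 1 => exact fun _ _ h => h
    | 2 => exact fun _ _ _ => Subsingleton.elim (α := PUnit) _ _
    | k + 3 => exact fun _ _ _ => Subsingleton.elim (α := PUnit) _ _
  · match k with
    | 0 => exact fun _ => ⟨0, Subsingleton.elim (α := PUnit) _ _⟩
    | 1 => exact fun _ => ⟨0, Subsingleton.elim (α := PUnit) _ _⟩
    | 2 => exact fun y => ⟨y, rfl⟩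
    | k + 3 => exact fun _ => ⟨0, Subsingleton.elim (α := PUnit) _ _⟩
  · match k with
    | 0 => exact ⟨y, rfl⟩
    | 1 => exact ⟨y, rfl⟩
    | 2 => exact ⟨0, (map_zero _).trans hy.symm⟩
    | k + 3 => exact ⟨0, Subsingleton.elim (α := PUnit) _ _⟩

end Filtration

/-! ### Cellular models of spaces -/

section Comb

variable {F : Type} [Fintype F] {L K : ModuleCat.{0} ℤ}

/-- The free module on a finite set. -/
abbrev freeOn (F : Type) : ModuleCat.{0} ℤ := ModuleCat.of ℤ (F → ℤ)

/-- The map from a free module on a finite set which takes given values on the basis. -/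
noncomputable def comb (e : F → L) : freeOn F ⟶ L :=
  ModuleCat.ofHom (Fintype.linearCombination ℤ e)

lemma comb_apply (e : F → L) (x : F → ℤ) : comb e x = ∑ i, x i • e i :=
  Finset.sum_congr rfl fun i _ => int_smul_eq_zsmul L.isModule (x i) (e i)

lemma comb_single [DecidableEq F] (e : F → L) (i : F) : comb e (Pi.single i 1) = e i :=
  (Fintype.linearCombination_apply_single ℤ e i 1).trans (L.isModule.one_smul _)

lemma hom_ext_single [DecidableEq F] {φ ψ : freeOn F ⟶ L}
    (h : ∀ i, φ (Pi.single i 1) = ψ (Pi.single i 1)) : φ = ψ := by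
  apply ModuleCat.hom_ext
  apply LinearMap.pi_ext'
  intro i
  ext
  exact h i

lemma comb_comp (e : F → L) (φ : L ⟶ K) : comb e ≫ φ = comb fun i => φ (e i) := by
  classical
  refine hom_ext_single fun i => ?_
  refine (congrArg φ (comb_single e i)).trans (comb_single (fun i => φ (e i)) i).symm

end Comb

namespace SingChain

variable {X Y : TopCat.{0}}

/-- The `0`-chain of a point. -/
noncomputable def point (x : X) : (singChains.obj X).X 0 := of (.const _ x)

/-- The `1`-chain of a path. -/
noncomputable def path (γ : C(unitInterval, X)) : (singChains.obj X).X 1 :=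
  of (γ.comp ⟨fun t : Splx 1 => ⟨t.1 1, t.2.1 1,
    t.2.2 ▸ Finset.single_le_sum (fun i _ => t.2.1 i) (Finset.mem_univ 1)⟩, by
      have := (continuous_apply (1 : Fin 2)).comp
        (continuous_subtype_val (p := (· ∈ stdSimplex ℝ (Fin 2))))
      exact this.subtype_mk _⟩)

lemma map_point (f : X ⟶ Y) (x : X) : (singChains.map f).f 0 (point x) = point (f x) :=
  map_of _ _

lemma map_path (f : X ⟶ Y) (γ : C(unitInterval, X)) :
    (singChains.map f).f 1 (path γ) = path (f.hom.comp γ) :=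
  map_of _ _

instance : Unique (Splx 0) := inferInstanceAs (Unique (stdSimplex ℝ (Fin 1)))

lemma of_eq_point (σ : C(Splx 0, X)) : of σ = point (σ default) := by
  refine congrArg of (ContinuousMap.ext fun t => ?_)
  rw [Subsingleton.elim t default]
  rfl

lemma splx_zero_apply (t : Splx 0) : t.1 0 = 1 := by
  have := t.2.2
  simpa using this

lemma face_zero_apply (t : Splx 0) : (face 0 t).1 (1 : Fin 2) = 1 := by
  rw [← splx_zero_apply t]
  refine (FunOnFinite.linearMap_apply_apply ℝ ℝ _ t.1 _).trans ?_
  have : (Finset.univ.filter fun i : Fin 1 => (0 : Fin 2).succAbove i = 1) = {0} := by decide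
  rw [this, Finset.sum_singleton]

lemma face_one_apply (t : Splx 0) : (face 1 t).1 (1 : Fin 2) = 0 := by
  refine (FunOnFinite.linearMap_apply_apply ℝ ℝ _ t.1 _).trans ?_
  have : (Finset.univ.filter fun i : Fin 1 => (1 : Fin 2).succAbove i = 1) = ∅ := by decide
  rw [this, Finset.sum_empty]

lemma d_path (γ : C(unitInterval, X)) :
    (singChains.obj X).d 1 0 (path γ) = point (γ 1) - point (γ 0) := by
  refine (d_of _).trans ?_
  rw [Fin.sum_univ_two, of_eq_point, of_eq_point, sub_eq_add_neg]
  congr 1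
  · refine (one_smul ℤ _).trans (congrArg point (congrArg γ (Subtype.ext ?_)))
    exact face_zero_apply _
  · refine (neg_one_smul ℤ _).trans (congrArg (fun x => -point x) (congrArg γ (Subtype.ext ?_)))
    exact face_one_apply _

end SingChain

section Discrete

variable {F : Type} [Fintype F]

/-- The singular chains of a finite totally disconnected space, whose points are listed by `p`, are
modelled by the free module on its points. -/
lemma quasiIso_discrete {A : TopCat.{0}} [TotallyDisconnectedSpace A] (p : F → A)
    (hp : p.Bijective) :
    QuasiIso (triple₀.hom (L := singChains.obj A) (comb fun i => point (p i))) := by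
  classical
  have hex : ∀ k, (singChains.obj A).ExactAt (k + 1) := fun k =>
    (AlgebraicTopology.singularChainComplexFunctor_exactAt_of_totallyDisconnectedSpace
      (ModuleCat.{0} ℤ) (k + 1) (ModuleCat.of ℤ ℤ) A (Nat.succ_ne_zero k)).of_iso
      (singChainsIso.app A)
  let E : (F → ℤ) ≃ₗ[ℤ] (C(Splx 0, A) →₀ ℤ) :=
    (Finsupp.linearEquivFunOnFinite ℤ ℤ F).symm ≪≫ₗ
      Finsupp.domLCongr (R := ℤ) (M := ℤ) ((Equiv.ofBijective p hp).trans
        { toFun := fun x => .const _ x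
          invFun := fun σ => σ default
          left_inv := fun x => rfl
          right_inv := fun σ => ContinuousMap.ext fun t => by
            rw [Subsingleton.elim t default]; rfl })
  have hE : comb (fun i => point (p i)) = ModuleCat.ofHom E.toLinearMap := by
    refine hom_ext_single fun i => (comb_single _ i).trans ?_
    symm
    change (Finsupp.domLCongr (R := ℤ) (M := ℤ) _)
      ((Finsupp.linearEquivFunOnFinite ℤ ℤ F).symm (Pi.single i 1)) = _
    rw [Finsupp.linearEquivFunOnFinite_symm_single, Finsupp.domLCongr_single]
    rfl
  have hd : ∀ y, (singChains.obj A).d 1 0 y = 0 := by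
    intro y
    have : ((singChains.obj A).d 1 0).hom = 0 := by
      refine SingChain.hom_ext fun σ => ?_
      refine (d_of _).trans ?_
      rw [Fin.sum_univ_two, of_eq_point, of_eq_point]
      have hσ : ∀ s t, σ s = σ t := fun s t =>
        ((isPreconnected_univ (α := Splx 1)).image σ σ.continuous.continuousOn).subsingleton
          ⟨s, trivial, rfl⟩ ⟨t, trivial, rfl⟩
      change (-1 : ℤ) ^ 0 • point (σ _) + (-1 : ℤ) ^ 1 • point (σ _) = 0
      rw [hσ (face 0 default) (face 1 default)]
      refine (congrArg₂ (· + ·) (one_smul ℤ _) (neg_one_smul ℤ _)).trans (add_neg_cancel _)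
    exact LinearMap.congr_fun this y
  refine quasiIso_of_injective _ (fun k => ?_) (fun y => ?_) fun k y w h => ?_
  · match k with
    | 0 =>
      intro x y h
      change comb _ x = comb _ y at h
      rw [hE] at h
      exact E.injective h
    | 1 => exact fun _ _ _ => Subsingleton.elim (α := PUnit) _ _
    | 2 => exact fun _ _ _ => Subsingleton.elim (α := PUnit) _ _
    | k + 3 => exact fun _ _ _ => Subsingleton.elim (α := PUnit) _ _
  · refine ⟨E.symm y, 0, ?_⟩
    rw [map_zero, add_zero]
    change _ = comb _ (E.symm y)
    rw [hE]
    exact (E.apply_symm_apply y).symm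
  · have hy : (singChains.obj A).d (k + 1) k y = 0 := by
      match k with
      | 0 => exact hd y
      | 1 => exact h.trans ((congrArg _ (Subsingleton.elim (α := PUnit) w 0)).trans (map_zero _))
      | 2 => exact h.trans ((congrArg _ (Subsingleton.elim (α := PUnit) w 0)).trans (map_zero _))
      | k + 3 =>
        exact h.trans ((congrArg _ (Subsingleton.elim (α := PUnit) w 0)).trans (map_zero _))
    obtain ⟨z, hz⟩ := (exactAt_succ_iff k).1 (hex k) y hy
    exact ⟨0, z, by rw [map_zero, zero_add, hz]⟩

lemma triple₀.hom_comp {M₀ : ModuleCat.{0} ℤ} {K L : ChainComplex (ModuleCat.{0} ℤ) ℕ}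
    (z : M₀ ⟶ K.X 0) (φ : K ⟶ L) : triple₀.hom z ≫ φ = triple₀.hom (z ≫ φ.f 0) :=
  triple.hom_ext (w := zero_comp) zero_comp zero_comp rfl

/-- The product of a finite discrete space `F` and a contractible one is modelled by the free module
on `F`. -/
lemma quasiIso_discrete_prod [TopologicalSpace F] [DiscreteTopology F] {Y : Type}
    [TopologicalSpace Y] [ContractibleSpace Y] (y₀ : Y) :
    QuasiIso (triple₀.hom (L := singChains.obj (TopCat.of (F × Y)))
      (comb fun i => point (X := TopCat.of (F × Y)) (i, y₀))) := by
  let s : TopCat.of F ⟶ TopCat.of (F × Y) := TopCat.ofHom ⟨fun i => (i, y₀), by fun_prop⟩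
  let r : TopCat.of (F × Y) ⟶ TopCat.of F := TopCat.ofHom ⟨Prod.fst, by fun_prop⟩
  obtain ⟨H⟩ : (ContinuousMap.id Y).Homotopic (.const Y y₀) := by
    obtain ⟨y, hy⟩ := id_nullhomotopic Y
    have : Nonempty Y := ⟨y⟩
    exact hy.trans (ContinuousMap.homotopic_const_iff.2 (PathConnectedSpace.joined y y₀))
  have h1 : QuasiIso (singChains.map s) := by
    refine quasiIso_of_deformation s r rfl ?_
    exact
      { toFun := fun p => (p.2.1, H (p.1, p.2.2))
        continuous_toFun := by fun_prop
        map_zero_left := fun x => Prod.ext rfl (H.apply_zero x.2)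
        map_one_left := fun x => Prod.ext rfl (H.apply_one x.2) }
  have h2 := quasiIso_discrete (A := TopCat.of F) id Function.bijective_id
  have h3 := quasiIso_comp (triple₀.hom (L := singChains.obj (TopCat.of F))
    (comb fun i => point (X := TopCat.of F) (id i))) (singChains.map s)
  rw [triple₀.hom_comp, comb_comp] at h3
  convert h3 using 4 with i
  exact (map_point s i).symm

/-- In positive degrees, cycles bound if there is a model concentrated in degree zero. -/
lemma exists_d_eq_of_quasiIso_triple₀ {M₀ : ModuleCat.{0} ℤ}
    {L : ChainComplex (ModuleCat.{0} ℤ) ℕ} (z : M₀ ⟶ L.X 0) [QuasiIso (triple₀.hom z)] (k : ℕ)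
    (y : L.X (k + 1)) (hy : L.d (k + 1) k y = 0) : ∃ w, L.d (k + 2) (k + 1) w = y := by
  refine (exactAt_succ_iff k).1 ?_ y hy
  rw [← quasiIsoAt_iff_exactAt (triple₀.hom z)]
  · infer_instance
  · rw [exactAt_succ_iff]
    refine fun y _ => ⟨0, ?_⟩
    match k with
    | 0 => exact Subsingleton.elim (α := PUnit) _ _
    | 1 => exact Subsingleton.elim (α := PUnit) _ _
    | k + 2 => exact Subsingleton.elim (α := PUnit) _ _

end Discrete

section Relative

variable {X : TopCat.{0}} {A : Set X} {M₂ M₁ M₀ : ModuleCat.{0} ℤ} {f : M₂ ⟶ M₁} {g : M₁ ⟶ M₀}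

lemma comp_cokernel_π_eq_zero {N : ModuleCat.{0} ℤ} {k l : ℕ} {x : N ⟶ (singChains.obj X).X k}
    {w : N ⟶ (singChains.obj (TopCat.of A)).X l}
    (h : x ≫ (singChains.obj X).d k l = w ≫ (singChains.map (subIncl A)).f l) :
    (x ≫ (cokernel.π (singChains.map (subIncl A))).f k) ≫ (relChains A).d k l = 0 := by
  rw [Category.assoc, (cokernel.π (singChains.map (subIncl A))).comm, ← Category.assoc, h,
    Category.assoc, ← comp_f, cokernel.condition]
  exact comp_zero

variable {z : M₀ ⟶ (singChains.obj (TopCat.of A)).X 0}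

/-- Given a model of `A` by its points, a two-term complex is a model of `X` if and only if its
degree one part is a model of the pair `(X, A)`. -/
lemma quasiIso_relative₁ {y : M₁ ⟶ (singChains.obj X).X 1}
    (hy : y ≫ (singChains.obj X).d 1 0 = (g ≫ z) ≫ (singChains.map (subIncl A)).f 0)
    (h : QuasiIso (triple₀.hom z)) :
    QuasiIso (triple₀₁.hom y (z ≫ (singChains.map (subIncl A)).f 0)
      (hy.trans (Category.assoc _ _ _))) ↔
    QuasiIso (triple₁.hom (y ≫ (cokernel.π (singChains.map (subIncl A))).f 1)
      (comp_cokernel_π_eq_zero hy)) := by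
  let φ : filtration₁ g ⟶ cokernelSequence (singChains.map (subIncl A)) :=
    { τ₁ := triple₀.hom z
      τ₂ := triple₀₁.hom y (z ≫ (singChains.map (subIncl A)).f 0)
        (hy.trans (Category.assoc _ _ _))
      τ₃ := triple₁.hom (y ≫ (cokernel.π (singChains.map (subIncl A))).f 1)
        (comp_cokernel_π_eq_zero hy)
      comm₁₂ := triple.hom_ext (w := zero_comp) (zero_comp.trans zero_comp.symm)
        (zero_comp.trans zero_comp.symm)
        (Category.id_comp _).symm
      comm₂₃ := triple.hom_ext (w := zero_comp) (zero_comp.trans zero_comp.symm)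
        (Category.id_comp _).symm (by
        refine Eq.trans ?_ zero_comp.symm
        change (z ≫ (singChains.map (subIncl A)).f 0) ≫
          (cokernel.π (singChains.map (subIncl A))).f 0 = 0
        rw [Category.assoc, ← comp_f, cokernel.condition]
        exact comp_zero) }
  exact ⟨fun h₂ => quasiIso_τ₃ φ (filtration₁_shortExact g) (cokernelSequence_shortExact _) h h₂,
    fun h₃ => quasiIso_middle φ (filtration₁_shortExact g) (cokernelSequence_shortExact _) h h₃⟩

/-- Given a two-term model of `A`, a three-term complex extending it is a model of `X` if and only
if its degree two part is a model of the pair `(X, A)`. -/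
lemma quasiIso_relative₂ {w : f ≫ g = 0} {y : M₁ ⟶ (singChains.obj (TopCat.of A)).X 1}
    {hy : y ≫ (singChains.obj (TopCat.of A)).d 1 0 = g ≫ z} {x : M₂ ⟶ (singChains.obj X).X 2}
    (hx : x ≫ (singChains.obj X).d 2 1 = (f ≫ y) ≫ (singChains.map (subIncl A)).f 1)
    {hy' : (y ≫ (singChains.map (subIncl A)).f 1) ≫ (singChains.obj X).d 1 0 =
      g ≫ z ≫ (singChains.map (subIncl A)).f 0} (h : QuasiIso (triple₀₁.hom y z hy)) :
    QuasiIso (triple.hom (w := w) x (y ≫ (singChains.map (subIncl A)).f 1)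
      (z ≫ (singChains.map (subIncl A)).f 0) (hx.trans (Category.assoc _ _ _)) hy') ↔
    QuasiIso (triple₂.hom (x ≫ (cokernel.π (singChains.map (subIncl A))).f 2)
      (comp_cokernel_π_eq_zero hx)) := by
  have h0 : ∀ k {N : ModuleCat.{0} ℤ} (u : N ⟶ (singChains.obj (TopCat.of A)).X k),
      (u ≫ (singChains.map (subIncl A)).f k) ≫
          (cokernel.π (singChains.map (subIncl A))).f k = 0 := by
    intro k N u
    rw [Category.assoc, ← comp_f, cokernel.condition]
    exact comp_zero
  let φ : filtration₂ f g w ⟶ cokernelSequence (singChains.map (subIncl A)) :=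
    { τ₁ := triple₀₁.hom y z hy
      τ₂ := triple.hom (w := w) x (y ≫ (singChains.map (subIncl A)).f 1)
        (z ≫ (singChains.map (subIncl A)).f 0) (hx.trans (Category.assoc _ _ _)) hy'
      τ₃ := triple₂.hom (x ≫ (cokernel.π (singChains.map (subIncl A))).f 2)
        (comp_cokernel_π_eq_zero hx)
      comm₁₂ := triple.hom_ext (w := zero_comp) (zero_comp.trans zero_comp.symm)
        (Category.id_comp _).symm
        (Category.id_comp _).symm
      comm₂₃ := triple.hom_ext (w := w) (Category.id_comp _).symm ((h0 1 y).trans zero_comp.symm)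
        ((h0 0 z).trans zero_comp.symm) }
  exact ⟨fun h₂ => quasiIso_τ₃ φ (filtration₂_shortExact f g w)
      (cokernelSequence_shortExact _) h h₂,
    fun h₃ => quasiIso_middle φ (filtration₂_shortExact f g w)
      (cokernelSequence_shortExact _) h h₃⟩

end Relative

/-! ### Attaching intervals and discs -/

open MatrixDiscComplex

namespace IsAttaching

variable {P X : Type} [TopologicalSpace P] [TopologicalSpace X] {f : P → X} {B : Set P} {A : Set X}

/-- The attaching map as a morphism of topological spaces. -/
abbrev toHom (h : IsAttaching f B A) : TopCat.of P ⟶ TopCat.of X :=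
  TopCat.ofHom ⟨f, h.continuous⟩

/-- Attaching one-dimensional cells: cellular models of `A` and of the pair `(P, B)` give a
cellular model of `X`. -/
lemma quasiIso_triple₀₁ (h : IsAttaching f B A) (hB : IsCollared B)
    {M₁ N₀ M₀ : ModuleCat.{0} ℤ} {g : M₁ ⟶ N₀} {g' : M₁ ⟶ M₀}
    {z : N₀ ⟶ (singChains.obj (TopCat.of B)).X 0} {y : M₁ ⟶ (singChains.obj (TopCat.of P)).X 1}
    (hy : y ≫ (singChains.obj (TopCat.of P)).d 1 0 =
      (g ≫ z) ≫ (singChains.map (subIncl (X := TopCat.of P) B)).f 0)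
    (hz : QuasiIso (triple₀.hom z))
    (hP : QuasiIso (triple₀₁.hom y (z ≫ (singChains.map (subIncl (X := TopCat.of P) B)).f 0)
      (hy.trans (Category.assoc _ _ _))))
    {z' : M₀ ⟶ (singChains.obj (TopCat.of A)).X 0} (hz' : QuasiIso (triple₀.hom z'))
    (hy' : (y ≫ (singChains.map h.toHom).f 1) ≫ (singChains.obj (TopCat.of X)).d 1 0 =
      (g' ≫ z') ≫ (singChains.map (subIncl (X := TopCat.of X) A)).f 0) :
    QuasiIso (triple₀₁.hom (y ≫ (singChains.map h.toHom).f 1)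
      (z' ≫ (singChains.map (subIncl (X := TopCat.of X) A)).f 0)
      (hy'.trans (Category.assoc _ _ _))) := by
  rw [quasiIso_relative₁ hy' hz']
  have h1 := (quasiIso_relative₁ hy hz).1 hP
  have h2 := h.quasiIso_relMap hB
  have h3 := quasiIso_comp (triple₁.hom (y ≫ (cokernel.π (singChains.map (subIncl
    (X := TopCat.of P) B))).f 1) (comp_cokernel_π_eq_zero hy)) (relMap h.toHom h.mapsTo)
  convert h3 using 1
  refine triple.hom_ext (w := zero_comp) (zero_comp.symm) ?_ zero_comp.symm
  have := congrArg (fun φ => y ≫ HomologicalComplex.Hom.f φ 1) (π_relMap h.toHom h.mapsTo)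
  refine Eq.trans ?_ (this.symm.trans ?_)
  · exact Category.assoc _ _ _
  · exact (Category.assoc _ _ _).symm

/-- Attaching two-dimensional cells: cellular models of `A` and of the pair `(P, B)` give a
cellular model of `X`. The two-dimensional chains of `X` may differ from those which come
from `P` by chains in `A`. -/
lemma quasiIso_triple (h : IsAttaching f B A) (hB : IsCollared B)
    {M₂ N₁ N₀ M₁ M₀ : ModuleCat.{0} ℤ} {g₂ : M₂ ⟶ N₁} {g₁ : N₁ ⟶ N₀} {w : g₂ ≫ g₁ = 0}
    {k₂ : M₂ ⟶ M₁} {k₁ : M₁ ⟶ M₀} {w' : k₂ ≫ k₁ = 0}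
    {z : N₀ ⟶ (singChains.obj (TopCat.of B)).X 0} {y : N₁ ⟶ (singChains.obj (TopCat.of B)).X 1}
    {hy : y ≫ (singChains.obj (TopCat.of B)).d 1 0 = g₁ ≫ z}
    (hB1 : QuasiIso (triple₀₁.hom y z hy)) {x : M₂ ⟶ (singChains.obj (TopCat.of P)).X 2}
    (hx : x ≫ (singChains.obj (TopCat.of P)).d 2 1 =
      (g₂ ≫ y) ≫ (singChains.map (subIncl (X := TopCat.of P) B)).f 1)
    {hy₀ : (y ≫ (singChains.map (subIncl (X := TopCat.of P) B)).f 1) ≫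
      (singChains.obj (TopCat.of P)).d 1 0 =
        g₁ ≫ z ≫ (singChains.map (subIncl (X := TopCat.of P) B)).f 0}
    (hP : QuasiIso (triple.hom (w := w) x
      (y ≫ (singChains.map (subIncl (X := TopCat.of P) B)).f 1)
      (z ≫ (singChains.map (subIncl (X := TopCat.of P) B)).f 0)
      (hx.trans (Category.assoc _ _ _)) hy₀))
    {z' : M₀ ⟶ (singChains.obj (TopCat.of A)).X 0} {y' : M₁ ⟶ (singChains.obj (TopCat.of A)).X 1}
    {hy' : y' ≫ (singChains.obj (TopCat.of A)).d 1 0 = k₁ ≫ z'}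
    (hA : QuasiIso (triple₀₁.hom y' z' hy'))
    {c : M₂ ⟶ (singChains.obj (TopCat.of A)).X 2}
    (hx' : (x ≫ (singChains.map h.toHom).f 2 +
        c ≫ (singChains.map (subIncl (X := TopCat.of X) A)).f 2) ≫
          (singChains.obj (TopCat.of X)).d 2 1 =
      (k₂ ≫ y') ≫ (singChains.map (subIncl (X := TopCat.of X) A)).f 1)
    {hy₀' : (y' ≫ (singChains.map (subIncl (X := TopCat.of X) A)).f 1) ≫
      (singChains.obj (TopCat.of X)).d 1 0 =
        k₁ ≫ z' ≫ (singChains.map (subIncl (X := TopCat.of X) A)).f 0} :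
    QuasiIso (triple.hom (w := w')
      (x ≫ (singChains.map h.toHom).f 2 +
        c ≫ (singChains.map (subIncl (X := TopCat.of X) A)).f 2)
      (y' ≫ (singChains.map (subIncl (X := TopCat.of X) A)).f 1)
      (z' ≫ (singChains.map (subIncl (X := TopCat.of X) A)).f 0)
      (hx'.trans (Category.assoc _ _ _)) hy₀') := by
  rw [quasiIso_relative₂ hx' hA]
  have h1 := (quasiIso_relative₂ hx hB1).1 hP
  have h2 := h.quasiIso_relMap hB
  have h3 := quasiIso_comp (triple₂.hom (x ≫ (cokernel.π (singChains.map (subIncl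
    (X := TopCat.of P) B))).f 2) (comp_cokernel_π_eq_zero hx)) (relMap h.toHom h.mapsTo)
  convert h3 using 1
  refine triple.hom_ext (w := zero_comp) ?_ zero_comp.symm zero_comp.symm
  have := congrArg (fun φ => x ≫ HomologicalComplex.Hom.f φ 2) (π_relMap h.toHom h.mapsTo)
  refine Eq.trans ?_ (this.symm.trans ?_)
  · refine (Preadditive.add_comp _ _ _ _ _ _).trans ?_
    have h0 : (c ≫ (singChains.map (subIncl (X := TopCat.of X) A)).f 2) ≫
        (cokernel.π (singChains.map (subIncl (X := TopCat.of X) A))).f 2 = 0 := by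
      rw [Category.assoc, ← comp_f, cokernel.condition]
      exact comp_zero
    rw [h0, add_zero]
    exact Category.assoc _ _ _
  · exact (Category.assoc _ _ _).symm

end IsAttaching

lemma comb_point_subIncl {F : Type} [Fintype F] {X : TopCat.{0}} {A : Set X} (a : F → A) :
    (comb fun i => point (X := TopCat.of A) (a i)) ≫ (singChains.map (subIncl A)).f 0 =
      comb fun i => point (a i).1 :=
  (comb_comp _ _).trans (congrArg _ (funext fun i => map_point (subIncl A) (a i)))

section Interval

variable {F : Type} [TopologicalSpace F]

instance : ContractibleSpace unitInterval :=
  (convex_Icc (0 : ℝ) 1).contractibleSpace ⟨0, by simp⟩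

variable (F) in
/-- The set of all endpoints in a disjoint union of intervals. -/
def endpoints : Set (F × unitInterval) := {p | p.2 = 0 ∨ p.2 = 1}

lemma isCollared_endpoints : IsCollared (endpoints F) := by
  -- The intervals are stretched from their midpoints and clamped.
  refine ⟨{p | p.2.1 < 1 / 4 ∨ 3 / 4 < p.2.1}, ⟨fun p => (p.1.1, Set.projIcc 0 1 zero_le_one
    (1 / 2 + (1 + p.2.1) * (p.1.2.1 - 1 / 2))), by fun_prop⟩, ?_, ?_, ?_, ?_, ?_, ?_⟩
  · have hc : Continuous fun p : F × unitInterval => p.2.1 := by fun_prop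
    exact (isOpen_lt hc continuous_const).union (isOpen_lt continuous_const hc)
  · rintro ⟨f, t⟩ (h | h) <;> simp only at h <;> subst h
    · left; norm_num
    · right; norm_num
  · rintro ⟨f, t⟩
    refine Prod.ext rfl ?_
    change Set.projIcc 0 1 zero_le_one (1 / 2 + (1 + 0) * (t.1 - 1 / 2)) = t
    rw [add_zero, one_mul, add_sub_cancel, Set.projIcc_val]
  · rintro ⟨f, t⟩ (h | h) s <;> simp only at h <;> subst h <;> refine Prod.ext rfl ?_
    · refine Set.projIcc_of_le_left zero_le_one ?_
      have := s.2.1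
      change 1 / 2 + (1 + s.1) * ((0 : ℝ) - 1 / 2) ≤ 0
      linarith
    · refine Set.projIcc_of_right_le zero_le_one ?_
      have := s.2.1
      change 1 ≤ 1 / 2 + (1 + s.1) * ((1 : ℝ) - 1 / 2)
      linarith
  · rintro ⟨f, t⟩ h s
    have hs := s.2.1
    change (Set.projIcc (0 : ℝ) 1 zero_le_one (1 / 2 + (1 + s.1) * (t.1 - 1 / 2))).1 < _ ∨
      _ < (Set.projIcc (0 : ℝ) 1 zero_le_one (1 / 2 + (1 + s.1) * (t.1 - 1 / 2))).1
    rw [Set.coe_projIcc]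
    rcases h with h | h <;> simp only at h
    · left
      refine max_lt (by norm_num) ((min_le_right _ _).trans_lt ?_)
      nlinarith
    · right
      refine lt_max_of_lt_right (lt_min (by norm_num) ?_)
      nlinarith
  · rintro ⟨f, t⟩ (h | h) <;> simp only at h
    · left
      refine Set.projIcc_of_le_left zero_le_one ?_
      change 1 / 2 + (1 + (1 : ℝ)) * (t.1 - 1 / 2) ≤ 0
      linarith
    · right
      refine Set.projIcc_of_right_le zero_le_one ?_
      change 1 ≤ 1 / 2 + (1 + (1 : ℝ)) * (t.1 - 1 / 2)
      linarith

/-- The homology of a graph with loops only: a space obtained from a finite discrete space `V` by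
attaching intervals `e (i, ·)` both of whose ends are attached to the same point. -/
theorem quasiIso_graph [Fintype F] [DiscreteTopology F] {X ι : Type} [TopologicalSpace X]
    [Fintype ι] {V : Set X}
    [TotallyDisconnectedSpace V] (v : ι → V) (hv : v.Bijective) {e : F × unitInterval → X}
    (h : IsAttaching e (endpoints F) V) (he : ∀ i, e (i, 1) = e (i, 0)) :
    ∃ hd, QuasiIso (triple₀₁.hom (g := (0 : freeOn F ⟶ freeOn ι))
      (L := singChains.obj (TopCat.of X))
      (comb fun i => path (X := TopCat.of X) ⟨fun t => e (i, t), h.continuous.comp (by fun_prop)⟩)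
      (comb fun i => point (X := TopCat.of X) (v i).1) hd) := by
  classical
  -- The endpoints of the intervals, indexed by `F × Bool`.
  let b : F × Bool → endpoints F := fun q =>
    ⟨(q.1, bif q.2 then 1 else 0), by cases q.2; exacts [Or.inl rfl, Or.inr rfl]⟩
  have hb : b.Bijective := by
    refine ⟨?_, ?_⟩
    · rintro ⟨i, s⟩ ⟨j, t⟩ hij
      have h1 := congrArg (fun x => x.1.1) hij
      have h2 := congrArg (fun x => x.1.2) hij
      cases s <;> cases t <;> simp_all [b]
    · rintro ⟨⟨i, t⟩, ht | ht⟩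
      · exact ⟨(i, false), Subtype.ext (Prod.ext rfl ht.symm)⟩
      · exact ⟨(i, true), Subtype.ext (Prod.ext rfl ht.symm)⟩
  have : Finite (endpoints F) := Finite.of_surjective b hb.2
  have hz := quasiIso_discrete (A := TopCat.of (endpoints F)) b hb
  have hz' := quasiIso_discrete (A := TopCat.of V) v hv
  let g : freeOn F ⟶ freeOn (F × Bool) :=
    comb fun i => (Pi.single (i, true) 1 - Pi.single (i, false) 1 : F × Bool → ℤ)
  have hg : ∀ (y : F → ℤ) q, g y q = bif q.2 then y q.1 else - y q.1 := by
    rintro y ⟨i, t⟩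
    have h1 : g y (i, t) = ∑ j, y j *
        ((Pi.single (j, true) 1 - Pi.single (j, false) 1 : F × Bool → ℤ) (i, t)) :=
      (congrFun (comb_apply _ y) (i, t)).trans (Finset.sum_apply _ _ _)
    rw [h1, Finset.sum_eq_single i]
    · cases t <;> simp
    · intro j _ hj
      simp [hj.symm]
    · simp
  let y : freeOn F ⟶ (singChains.obj (TopCat.of (F × unitInterval))).X 1 :=
    comb fun i => path (X := TopCat.of (F × unitInterval)) ⟨fun t => (i, t), by fun_prop⟩
  have hy : y ≫ (singChains.obj (TopCat.of (F × unitInterval))).d 1 0 =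
      (g ≫ comb fun q => point (X := TopCat.of (endpoints F)) (b q)) ≫
        (singChains.map (subIncl (X := TopCat.of (F × unitInterval)) (endpoints F))).f 0 := by
    refine hom_ext_single fun i => ?_
    refine (congrArg ((singChains.obj (TopCat.of (F × unitInterval))).d 1 0)
      (comb_single _ i)).trans ((d_path _).trans ?_)
    rw [Category.assoc, comb_point_subIncl (X := TopCat.of (F × unitInterval))]
    refine Eq.trans ?_ (congrArg (comb fun q => point (X := TopCat.of (F × unitInterval)) (b q).1)
      (comb_single _ i)).symm
    rw [map_sub, comb_single, comb_single]
    rfl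
  have hP : QuasiIso (triple₀₁.hom y ((comb fun q => point (X := TopCat.of (endpoints F)) (b q)) ≫
      (singChains.map (subIncl (X := TopCat.of (F × unitInterval)) (endpoints F))).f 0)
      (hy.trans (Category.assoc _ _ _))) := by
    -- The intervals are contractible, so it suffices to see that the model reduces to the free
    -- module on their starting points.
    let s : freeOn F ⟶ freeOn (F × Bool) := comb fun i => (Pi.single (i, false) 1 : F × Bool → ℤ)
    have hs : ∀ (y : F → ℤ) q, s y q = bif q.2 then 0 else y q.1 := by
      rintro y ⟨i, t⟩
      have h1 : s y (i, t) = ∑ j, y j * ((Pi.single (j, false) 1 : F × Bool → ℤ) (i, t)) :=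
        (congrFun (comb_apply _ y) (i, t)).trans (Finset.sum_apply _ _ _)
      rw [h1, Finset.sum_eq_single i]
      · cases t <;> simp
      · intro j _ hj
        simp [hj.symm]
      · simp
    have q1 : QuasiIso (triple₀.hom (L := triple₀₁ g) s) := by
      refine quasiIso_of_injective _ (fun k => ?_) (fun y => ?_) fun k y w h => ?_
      · match k with
        | 0 =>
          intro x y h
          funext i
          have := congrFun h (i, false)
          exact (hs x (i, false)).symm.trans (this.trans (hs y (i, false)))
        | 1 => exact fun _ _ _ => Subsingleton.elim (α := PUnit) _ _
        | 2 => exact fun _ _ _ => Subsingleton.elim (α := PUnit) _ _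
        | k + 3 => exact fun _ _ _ => Subsingleton.elim (α := PUnit) _ _
      · refine ⟨fun i => y (i, true) + y (i, false), fun i => y (i, true), ?_⟩
        rw [triple.d_eq]
        funext ⟨i, t⟩
        refine Eq.trans ?_ (congrArg₂ (· + ·) (hs _ (i, t)) (hg _ (i, t))).symm
        cases t
        · change y (i, false) = (y (i, true) + y (i, false)) + - y (i, true)
          ring
        · exact (zero_add _).symm
      · match k with
        | 0 =>
          refine ⟨0, 0, ?_⟩
          rw [triple.d_eq] at h
          rw [map_zero, map_zero, add_zero]
          funext i
          exact (hg y (i, true)).symm.trans ((congrFun h (i, true)).trans (hs w (i, true)))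
        | 1 => exact ⟨0, 0, Subsingleton.elim (α := PUnit) _ _⟩
        | k + 2 => exact ⟨0, 0, Subsingleton.elim (α := PUnit) _ _⟩
    have q2 := quasiIso_discrete_prod (F := F) (Y := unitInterval) 0
    have q3 : triple₀.hom (L := triple₀₁ g) s ≫ triple₀₁.hom y
        ((comb fun q => point (X := TopCat.of (endpoints F)) (b q)) ≫
          (singChains.map (subIncl (X := TopCat.of (F × unitInterval)) (endpoints F))).f 0)
        (hy.trans (Category.assoc _ _ _)) =
        triple₀.hom (L := singChains.obj (TopCat.of (F × unitInterval)))
          (comb fun i => point (X := TopCat.of (F × unitInterval)) (i, 0)) := by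
      refine triple.hom_ext (w := zero_comp) zero_comp zero_comp ?_
      refine hom_ext_single fun i => ?_
      refine Eq.trans ?_ (comb_single _ i).symm
      change ((comb fun q => point (X := TopCat.of (endpoints F)) (b q)) ≫
        (singChains.map (subIncl (X := TopCat.of (F × unitInterval)) (endpoints F))).f 0)
          (s (Pi.single i 1)) = _
      rw [comb_point_subIncl (X := TopCat.of (F × unitInterval))]
      refine (congrArg (comb fun q => point (X := TopCat.of (F × unitInterval)) (b q).1)
        (comb_single _ i)).trans ?_
      rw [comb_single]
      rfl
    rw [← q3] at q2
    exact quasiIso_of_comp_left (triple₀.hom (L := triple₀₁ g) s) _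
  have hy' : (y ≫ (singChains.map h.toHom).f 1) ≫ (singChains.obj (TopCat.of X)).d 1 0 =
      ((0 : freeOn F ⟶ freeOn ι) ≫ comb fun i => point (X := TopCat.of V) (v i)) ≫
        (singChains.map (subIncl (X := TopCat.of X) V)).f 0 := by
    refine hom_ext_single fun i => ?_
    refine (congrArg (fun c => (singChains.obj (TopCat.of X)).d 1 0
      ((singChains.map h.toHom).f 1 c)) (comb_single _ i)).trans ?_
    rw [map_path]
    refine (d_path _).trans ?_
    change point (X := TopCat.of X) (e (i, 1)) - point (X := TopCat.of X) (e (i, 0)) = _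
    rw [he, sub_self]
    rw [Limits.zero_comp, Limits.zero_comp]
    rfl
  have key := h.quasiIso_triple₀₁ isCollared_endpoints hy hz hP hz' hy'
  have e1 : y ≫ (singChains.map h.toHom).f 1 = comb fun i => path (X := TopCat.of X)
      ⟨fun t => e (i, t), h.continuous.comp (by fun_prop)⟩ := by
    refine (comb_comp _ _).trans (congrArg _ (funext fun i => ?_))
    exact map_path h.toHom _
  have e2 := comb_point_subIncl (X := TopCat.of X) v
  simp only [e1, e2] at key
  exact ⟨_, key⟩

end Interval

section Disc

instance : ContractibleSpace Disc :=
  (convex_closedBall (0 : ℂ) 1).contractibleSpace ⟨0, by simp⟩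

lemma continuous_boundaryPoint : Continuous boundaryPoint := by
  have : Continuous fun θ : ℝ => (Circle.exp (2 * Real.pi * θ) : ℂ) := by fun_prop
  exact this.subtype_mk _

lemma norm_boundaryPoint (θ : ℝ) : ‖(boundaryPoint θ).1‖ = 1 := Circle.norm_coe _

lemma boundaryPoint_eq_iff {θ η : ℝ} : boundaryPoint θ = boundaryPoint η ↔ ∃ k : ℤ, θ = η + k := by
  have h : boundaryPoint θ = boundaryPoint η ↔
      Circle.exp (2 * Real.pi * θ) = Circle.exp (2 * Real.pi * η) :=
    ⟨fun h => Circle.ext (congrArg (fun z : Disc => z.1) h),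
      fun h => Subtype.ext (Circle.ext_iff.1 h)⟩
  rw [h, Circle.exp_eq_exp]
  refine exists_congr fun k => ?_
  have := Real.pi_pos
  constructor
  · intro h
    have h2 : 2 * Real.pi * (θ - (η + k)) = 0 := by linarith
    rcases mul_eq_zero.1 h2 with h3 | h3 <;> linarith
  · rintro rfl
    ring

lemma exists_boundaryPoint {z : Disc} (hz : ‖z.1‖ = 1) :
    ∃ θ : ℝ, 0 ≤ θ ∧ θ < 1 ∧ boundaryPoint θ = z := by
  obtain ⟨x, hx⟩ := Circle.exp_surjective ⟨z.1, mem_sphere_zero_iff_norm.2 hz⟩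
  have h1 : boundaryPoint (x / (2 * Real.pi)) = z := by
    refine Subtype.ext ?_
    change ((Circle.exp _ : Circle) : ℂ) = _
    rw [mul_div_cancel₀ _ (by positivity), hx]
  refine ⟨Int.fract (x / (2 * Real.pi)), Int.fract_nonneg _, Int.fract_lt_one _, ?_⟩
  rw [← h1, boundaryPoint_eq_iff]
  exact ⟨-⌊x / (2 * Real.pi)⌋, by rw [Int.fract]; push_cast; ring⟩

variable {F : Type} [TopologicalSpace F]

variable (F) in
/-- The union of the boundary circles of a disjoint union of discs. -/
def circles : Set (F × Disc) := {p | ‖p.2.1‖ = 1}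

lemma isCollared_circles : IsCollared (circles F) := by
  -- The discs are stretched radially and points beyond the boundary are projected back to it.
  let r : C((F × Disc) × unitInterval, F × Disc) :=
    ⟨fun p => (p.1.1, ⟨(((1 + p.2.1) / max 1 ((1 + p.2.1) * ‖p.1.2.1‖) : ℝ) : ℂ) * p.1.2.1, by
      have := p.2.2.1
      rw [mem_closedBall_zero_iff, norm_mul, Complex.norm_real, Real.norm_eq_abs,
        abs_of_nonneg (by positivity), div_mul_eq_mul_div]
      exact div_le_one_of_le₀ (le_max_right _ _) (by positivity)⟩), by
      refine Continuous.prodMk (by fun_prop) (Continuous.subtype_mk ?_ _)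
      refine Continuous.mul (Complex.continuous_ofReal.comp ?_) (by fun_prop)
      exact Continuous.div (by fun_prop) (by fun_prop) fun p => by positivity⟩
  have hr : ∀ p s, ‖(r (p, s)).2.1‖ = min ((1 + s.1) * ‖p.2.1‖) 1 := by
    intro p s
    have := s.2.1
    change ‖((((1 + s.1) / max 1 ((1 + s.1) * ‖p.2.1‖) : ℝ) : ℂ) * p.2.1)‖ = _
    rw [norm_mul, Complex.norm_real, Real.norm_eq_abs, abs_of_nonneg (by positivity),
      div_mul_eq_mul_div]
    rcases le_total 1 ((1 + s.1) * ‖p.2.1‖) with h | h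
    · rw [max_eq_right h, min_eq_right h, div_self (by positivity)]
    · rw [max_eq_left h, min_eq_left h, div_one]
  have hc : Continuous fun p : F × Disc => ‖p.2.1‖ := by fun_prop
  refine ⟨{p | 1 / 2 < ‖p.2.1‖}, r, isOpen_lt continuous_const hc, ?_, ?_, ?_, ?_, ?_⟩
  · intro p hp
    change 1 / 2 < ‖p.2.1‖
    rw [show ‖p.2.1‖ = 1 from hp]
    norm_num
  · rintro ⟨f, z⟩
    refine Prod.ext rfl (Subtype.ext ?_)
    change (((1 + 0) / max 1 ((1 + 0) * ‖z.1‖) : ℝ) : ℂ) * z.1 = z.1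
    rw [add_zero, one_mul, max_eq_left (mem_closedBall_zero_iff.1 z.2)]
    simp
  · rintro ⟨f, z⟩ hz s
    have := s.2.1
    refine Prod.ext rfl (Subtype.ext ?_)
    change (((1 + s.1) / max 1 ((1 + s.1) * ‖z.1‖) : ℝ) : ℂ) * z.1 = z.1
    rw [show ‖z.1‖ = 1 from hz, mul_one, max_eq_right (by linarith), div_self (by positivity)]
    simp
  · intro p hp s
    have := s.2.1
    change 1 / 2 < ‖(r (p, s)).2.1‖
    change 1 / 2 < ‖p.2.1‖ at hp
    rw [hr]
    refine lt_min ?_ (by norm_num)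
    nlinarith
  · intro p hp
    change ‖(r (p, 1)).2.1‖ = 1
    change 1 / 2 < ‖p.2.1‖ at hp
    rw [hr]
    refine min_eq_right ?_
    change 1 ≤ (1 + 1) * ‖p.2.1‖
    linarith

/-- The boundary circles of the discs, parametrized by intervals. -/
noncomputable def circleParam (p : F × unitInterval) : circles F :=
  ⟨(p.1, boundaryPoint p.2), norm_boundaryPoint _⟩

variable (F) in
/-- The base points of the boundary circles. -/
def basePoints : Set (circles F) := {b | b.1.2 = boundaryPoint 0}

lemma isAttaching_circleParam [Finite F] [DiscreteTopology F] :
    IsAttaching (circleParam (F := F)) (endpoints F) (basePoints F) := by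
  have hc : Continuous (circleParam (F := F)) := by
    refine Continuous.subtype_mk (Continuous.prodMk continuous_fst ?_) _
    exact continuous_boundaryPoint.comp (by fun_prop)
  have hs : Function.Surjective (circleParam (F := F)) := by
    rintro ⟨⟨f, z⟩, hz⟩
    obtain ⟨θ, h0, h1, h⟩ := exists_boundaryPoint hz
    exact ⟨(f, ⟨θ, h0, h1.le⟩), Subtype.ext (Prod.ext rfl h)⟩
  have hpre : circleParam ⁻¹' basePoints F = endpoints F := by
    ext ⟨f, t⟩
    change boundaryPoint t = boundaryPoint 0 ↔ t = 0 ∨ t = 1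
    rw [boundaryPoint_eq_iff]
    constructor
    · rintro ⟨k, hk⟩
      rw [zero_add] at hk
      have h0 := t.2.1
      have h1 := t.2.2
      rw [hk] at h0 h1
      have h2 : 0 ≤ k := by exact_mod_cast h0
      have h3 : k ≤ 1 := by exact_mod_cast h1
      obtain rfl | rfl : k = 0 ∨ k = 1 := by omega
      · exact Or.inl (Subtype.ext (by simpa using hk))
      · exact Or.inr (Subtype.ext (by simpa using hk))
    · rintro (rfl | rfl)
      · exact ⟨0, by simp⟩
      · exact ⟨1, by simp⟩
  refine ⟨hc, ?_, hpre, ?_, fun x _ => hs x, fun Z _ hZ => ?_⟩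
  · exact (isClosed_eq continuous_snd continuous_const).union
      (isClosed_eq continuous_snd continuous_const)
  · rintro ⟨f, s⟩ hs ⟨g, t⟩ ht h
    have h1 : f = g := congrArg (fun b => b.1.1) h
    have h2 : boundaryPoint s = boundaryPoint t := congrArg (fun b => b.1.2) h
    obtain ⟨k, hk⟩ := boundaryPoint_eq_iff.1 h2
    have hs' : s ≠ 0 ∧ s ≠ 1 := not_or.1 hs
    have ht' : t ≠ 0 ∧ t ≠ 1 := not_or.1 ht
    have a1 := unitInterval.pos_iff_ne_zero.2 hs'.1
    have a2 := unitInterval.lt_one_iff_ne_one.2 hs'.2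
    have a3 := unitInterval.pos_iff_ne_zero.2 ht'.1
    have a4 := unitInterval.lt_one_iff_ne_one.2 ht'.2
    replace a1 : (0 : ℝ) < s := a1
    replace a2 : (s : ℝ) < 1 := a2
    replace a3 : (0 : ℝ) < t := a3
    replace a4 : (t : ℝ) < 1 := a4
    have b1 : ((-1 : ℤ) : ℝ) < k := by push_cast; linarith
    have b2 : (k : ℝ) < ((1 : ℤ) : ℝ) := by push_cast; linarith
    have b3 : k = 0 := by
      have := Int.cast_lt.1 b1
      have := Int.cast_lt.1 b2
      omega
    refine Prod.ext h1 (Subtype.ext ?_)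
    rw [hk, b3, Int.cast_zero, add_zero]
  · rw [← Set.image_preimage_eq Z hs]
    exact hc.isClosedMap _ hZ

/-- The boundary loop of a disc. -/
noncomputable def circleLoop (i : F) : C(unitInterval, TopCat.of (circles F)) :=
  ⟨fun t => circleParam (i, t), by
    refine Continuous.subtype_mk (Continuous.prodMk continuous_const ?_) _
    exact continuous_boundaryPoint.comp (by fun_prop)⟩

/-- A cellular model of a disjoint union of circles, and of the pair consisting of the discs and
their boundary circles. -/
theorem exists_quasiIso_discs [Fintype F] [DecidableEq F] [DiscreteTopology F] :
    ∃ (z : freeOn F ⟶ (singChains.obj (TopCat.of (circles F))).X 0)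
      (hd : (comb fun i : F => path (circleLoop i)) ≫
        (singChains.obj (TopCat.of (circles F))).d 1 0 =
          (0 : freeOn F ⟶ freeOn F) ≫ z)
      (x : freeOn F ⟶ (singChains.obj (TopCat.of (F × Disc))).X 2)
      (hx : x ≫ (singChains.obj (TopCat.of (F × Disc))).d 2 1 =
        (𝟙 (freeOn F) ≫ comb fun i : F => path (circleLoop i)) ≫
          (singChains.map (subIncl (X := TopCat.of (F × Disc)) (circles F))).f 1)
      (hy : ((comb fun i : F => path (circleLoop i)) ≫
        (singChains.map (subIncl (X := TopCat.of (F × Disc)) (circles F))).f 1) ≫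
        (singChains.obj (TopCat.of (F × Disc))).d 1 0 =
          (0 : freeOn F ⟶ freeOn F) ≫ z ≫
            (singChains.map (subIncl (X := TopCat.of (F × Disc)) (circles F))).f 0),
      QuasiIso (triple₀₁.hom (comb fun i : F => path (circleLoop i)) z hd) ∧
      QuasiIso (triple.hom (w := comp_zero) x
        ((comb fun i : F => path (circleLoop i)) ≫
          (singChains.map (subIncl (X := TopCat.of (F × Disc)) (circles F))).f 1)
        (z ≫ (singChains.map (subIncl (X := TopCat.of (F × Disc)) (circles F))).f 0)
        (hx.trans (Category.assoc _ _ _)) hy) := by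
  let v : F → basePoints F := fun i => ⟨⟨(i, boundaryPoint 0), norm_boundaryPoint 0⟩, rfl⟩
  have hv : v.Bijective := by
    refine ⟨fun i j h => congrArg (fun b => b.1.1.1) h, ?_⟩
    rintro ⟨⟨⟨i, z⟩, hz⟩, h⟩
    exact ⟨i, Subtype.ext (Subtype.ext (Prod.ext rfl h.symm))⟩
  have : Finite (basePoints F) := Finite.of_surjective v hv.2
  obtain ⟨hd, h1⟩ := quasiIso_graph v hv isAttaching_circleParam fun i => Subtype.ext (Prod.ext rfl
    (boundaryPoint_eq_iff.2 ⟨1, by simp⟩))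
  let z : freeOn F ⟶ (singChains.obj (TopCat.of (circles F))).X 0 :=
    comb fun i => point (X := TopCat.of (circles F)) (v i).1
  have q2 := quasiIso_discrete_prod (F := F) (Y := Disc) (boundaryPoint 0)
  -- The boundary loop of a disc is a cycle, hence bounds in the contractible disc.
  have hloop : ∀ i : F, ∃ c, (singChains.obj (TopCat.of (F × Disc))).d 2 1 c =
      (singChains.map (subIncl (X := TopCat.of (F × Disc)) (circles F))).f 1
        (path (circleLoop i)) := by
    intro i
    refine exists_d_eq_of_quasiIso_triple₀
      (comb fun i => point (X := TopCat.of (F × Disc)) (i, boundaryPoint 0)) 0 _ ?_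
    rw [comm_apply, d_path]
    have : circleLoop i 1 = circleLoop i 0 :=
      Subtype.ext (Prod.ext rfl (boundaryPoint_eq_iff.2 ⟨1, by simp⟩))
    rw [this, sub_self, map_zero]
  choose c hc using hloop
  have hx : comb c ≫ (singChains.obj (TopCat.of (F × Disc))).d 2 1 =
      (𝟙 (freeOn F) ≫ comb fun i : F => path (circleLoop i)) ≫
        (singChains.map (subIncl (X := TopCat.of (F × Disc)) (circles F))).f 1 := by
    rw [Category.id_comp, comb_comp, comb_comp]
    exact congrArg _ (funext hc)
  have hy : ((comb fun i : F => path (circleLoop i)) ≫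
      (singChains.map (subIncl (X := TopCat.of (F × Disc)) (circles F))).f 1) ≫
      (singChains.obj (TopCat.of (F × Disc))).d 1 0 =
        (0 : freeOn F ⟶ freeOn F) ≫ z ≫
          (singChains.map (subIncl (X := TopCat.of (F × Disc)) (circles F))).f 0 := by
    rw [Category.assoc, (singChains.map _).comm, ← Category.assoc]
    exact (congrArg (· ≫ _) hd).trans (Category.assoc _ _ _)
  refine ⟨z, hd, comb c, hx, hy, h1, ?_⟩
  -- The discs are contractible, so it suffices to see that the model reduces to the free module on
  -- their base points.
  have q1 : QuasiIso (triple₀.hom (L := triple (𝟙 (freeOn F)) (0 : freeOn F ⟶ freeOn F) comp_zero)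
      (𝟙 (freeOn F))) := by
    refine quasiIso_of_injective _ (fun k => ?_) (fun y => ?_) fun k y w h => ?_
    · match k with
      | 0 => exact fun _ _ h => h
      | 1 => exact fun _ _ _ => Subsingleton.elim (α := PUnit) _ _
      | 2 => exact fun _ _ _ => Subsingleton.elim (α := PUnit) _ _
      | k + 3 => exact fun _ _ _ => Subsingleton.elim (α := PUnit) _ _
    · exact ⟨y, 0, by rw [map_zero, add_zero]; rfl⟩
    · match k with
      | 0 =>
        refine ⟨0, y, ?_⟩
        rw [triple.d_eq, map_zero]
        exact (zero_add _).symm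
      | 1 =>
        refine ⟨0, 0, ?_⟩
        rw [triple.d_eq] at h
        rw [map_zero, map_zero, add_zero]
        exact h
      | k + 2 => exact ⟨0, 0, Subsingleton.elim (α := PUnit) _ _⟩
  have q3 : triple₀.hom (𝟙 (freeOn F)) ≫ triple.hom (w := comp_zero) (comb c)
        ((comb fun i : F => path (circleLoop i)) ≫
          (singChains.map (subIncl (X := TopCat.of (F × Disc)) (circles F))).f 1)
        (z ≫ (singChains.map (subIncl (X := TopCat.of (F × Disc)) (circles F))).f 0)
        (hx.trans (Category.assoc _ _ _)) hy =
      triple₀.hom (L := singChains.obj (TopCat.of (F × Disc)))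
        (comb fun i => point (X := TopCat.of (F × Disc)) (i, boundaryPoint 0)) := by
    refine triple.hom_ext (w := zero_comp) zero_comp zero_comp ?_
    refine (Category.id_comp _).trans ?_
    refine (comb_comp _ _).trans (congrArg _ (funext fun i => ?_))
    exact map_point (subIncl (X := TopCat.of (F × Disc)) (circles F)) _
  rw [← q3] at q2
  exact quasiIso_of_comp_left (triple₀.hom (L := triple (𝟙 (freeOn F))
    (0 : freeOn F ⟶ freeOn F) comp_zero) (𝟙 (freeOn F))) _

/-- The homology of a space obtained from `A` by attaching discs. The boundary loops of the discs
are homologous to the prescribed linear combinations of the one-dimensional cells of `A`. -/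
theorem IsAttaching.exists_quasiIso [Fintype F] [DecidableEq F] [DiscreteTopology F] {X : Type}
    [TopologicalSpace X] {A : Set X} {q : F × Disc → X} (h : IsAttaching q (circles F) A)
    {M₁ M₀ : ModuleCat.{0} ℤ} {k₁ : M₁ ⟶ M₀}
    {z' : M₀ ⟶ (singChains.obj (TopCat.of A)).X 0} {y' : M₁ ⟶ (singChains.obj (TopCat.of A)).X 1}
    {hy' : y' ≫ (singChains.obj (TopCat.of A)).d 1 0 = k₁ ≫ z'}
    (hA : QuasiIso (triple₀₁.hom y' z' hy')) {k₂ : freeOn F ⟶ M₁} {w' : k₂ ≫ k₁ = 0}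
    (hbd : ∀ i, ∃ c, (singChains.obj (TopCat.of A)).d 2 1 c =
      y' (k₂ (Pi.single i 1 : F → ℤ)) - (singChains.map (subMap h.toHom h.mapsTo)).f 1
        (path (circleLoop i))) :
    ∃ φ : triple k₂ k₁ w' ⟶ singChains.obj (TopCat.of X), QuasiIso φ := by
  obtain ⟨z, hd, x, hx, hy, h1, h2⟩ := exists_quasiIso_discs (F := F)
  choose c hc using hbd
  refine ⟨_, h.quasiIso_triple isCollared_circles h1 hx h2 hA (c := comb c) ?_ (hy₀' := ?_)⟩
  · refine hom_ext_single fun i => ?_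
    have e1 : (singChains.obj (TopCat.of (F × Disc))).d 2 1 (x (Pi.single i 1 : F → ℤ)) =
        (singChains.map (subIncl (X := TopCat.of (F × Disc)) (circles F))).f 1
          (path (circleLoop i)) := by
      refine (congrArg (fun ψ => ψ.hom (Pi.single i 1 : F → ℤ)) hx).trans ?_
      exact congrArg ((singChains.map (subIncl (X := TopCat.of (F × Disc)) (circles F))).f 1)
        (comb_single (fun i : F => path (circleLoop i)) i)
    have e2 : (singChains.map h.toHom).f 1 ((singChains.map (subIncl (X := TopCat.of (F × Disc))
        (circles F))).f 1 (path (circleLoop i))) = (singChains.map (subIncl (X := TopCat.of X)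
          A)).f 1 ((singChains.map (subMap h.toHom h.mapsTo)).f 1 (path (circleLoop i))) := by
      simp only [map_path]
      rfl
    have e3 : (comb c : freeOn F ⟶ _) (Pi.single i 1 : F → ℤ) = c i := comb_single c i
    change (singChains.obj (TopCat.of X)).d 2 1 ((singChains.map h.toHom).f 2
      (x (Pi.single i 1 : F → ℤ)) + (singChains.map (subIncl (X := TopCat.of X) A)).f 2
        ((comb c : freeOn F ⟶ _) (Pi.single i 1 : F → ℤ))) = (singChains.map (subIncl
          (X := TopCat.of X) A)).f 1 (y' (k₂ (Pi.single i 1 : F → ℤ)))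
    rw [map_add, comm_apply, comm_apply, e3, hc, e1, e2, map_sub, add_sub_cancel]
  · rw [Category.assoc, (singChains.map _).comm, ← Category.assoc]
    exact (congrArg (· ≫ _) hy').trans (Category.assoc _ _ _)

end Disc

/-! ### The skeleta of a matrix disc complex -/

namespace EdgeOrdering

variable {m n : ℕ} {M : Matrix (Fin m) (Fin n) ℤ} (E : EdgeOrdering M)

/-- The projection of the closed cells to the complex. -/
def proj (c : Cells m n) : E.toComplex := Quot.mk _ c

lemma continuous_proj : Continuous E.proj := continuous_quot_mk

/-- The union of the vertex and the edges. -/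
def skeleton : Set E.toComplex := {x | ∃ c : Unit ⊕ (Fin n × unitInterval),
  E.proj (c.elim (fun _ => vertex) fun p => edge p.1 p.2) = x}

lemma proj_vertex_mem : E.proj vertex ∈ E.skeleton := ⟨Sum.inl (), rfl⟩

lemma proj_edge_mem (j : Fin n) (t : unitInterval) : E.proj (edge j t) ∈ E.skeleton :=
  ⟨Sum.inr (j, t), rfl⟩

/-- The map of the intervals to the one-skeleton. -/
def edgeMap (p : Fin n × unitInterval) : E.skeleton := ⟨E.proj (edge p.1 p.2), E.proj_edge_mem _ _⟩

/-- The map of the discs to the complex. -/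
def discMap (p : Fin m × Disc) : E.toComplex := E.proj (disc p.1 p.2)

lemma continuous_edgeMap : Continuous E.edgeMap :=
  (E.continuous_proj.comp (continuous_inr.comp continuous_inl)).subtype_mk _

lemma continuous_discMap : Continuous E.discMap :=
  E.continuous_proj.comp (continuous_inr.comp continuous_inr)

lemma proj_edge_zero (j : Fin n) : E.proj (edge j 0) = E.proj vertex := Quot.sound (.edge_start j)

lemma proj_edge_one (j : Fin n) : E.proj (edge j 1) = E.proj vertex := Quot.sound (.edge_end j)

lemma entry_label_ne_zero (i : Fin m) (k : Fin (M.discSize i)) : M i (E.label i k) ≠ 0 := by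
  intro h
  have h1 := E.card_label i (E.label i k)
  rw [h, Int.natAbs_zero, Finset.card_eq_zero] at h1
  have h2 : k ∈ Finset.univ.filter fun l => E.label i l = E.label i k := by simp
  rw [h1] at h2
  exact Finset.notMem_empty _ h2

/-- The parameter on the edge to which the parameter `t` of the `k`-th arc of the `i`-th circle is
glued: it depends on the direction in which the edge is traversed. -/
def arcParam (i : Fin m) (k : Fin (M.discSize i)) (t : unitInterval) : unitInterval :=
  if 0 < M i (E.label i k) then t else unitInterval.symm t

lemma continuous_arcParam (i : Fin m) (k : Fin (M.discSize i)) :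
    Continuous (E.arcParam i k) := by
  by_cases h : 0 < M i (E.label i k)
  · exact continuous_id.congr fun t => (if_pos h).symm
  · exact unitInterval.continuous_symm.congr fun t => (if_neg h).symm

/-- The `k`-th arc of the `i`-th circle. -/
noncomputable def arc (i : Fin m) (k : Fin (M.discSize i)) (t : unitInterval) : Disc :=
  boundaryPoint (((k : ℕ) + (t : ℝ)) / (M.discSize i : ℝ))

lemma proj_disc_arc (i : Fin m) (k : Fin (M.discSize i)) (t : unitInterval) :
    E.proj (disc i (arc i k t)) = E.proj (edge (E.label i k) (E.arcParam i k t)) := by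
  by_cases h : 0 < M i (E.label i k)
  · rw [arcParam, if_pos h]
    exact Quot.sound (.disc_forward i k t h)
  · rw [arcParam, if_neg h]
    exact Quot.sound (.disc_backward i k t
      (lt_of_le_of_ne (not_lt.1 h) (E.entry_label_ne_zero i k)))

/-- The arcs cover the boundary circle. -/
lemma exists_arc (i : Fin m) (hi : M.discSize i ≠ 0) {z : Disc} (hz : ‖z.1‖ = 1) :
    ∃ k t, arc (M := M) i k t = z := by
  obtain ⟨θ, h0, h1, rfl⟩ := exists_boundaryPoint hz
  have hs : (0 : ℝ) < M.discSize i := by exact_mod_cast Nat.pos_of_ne_zero hi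
  have h2 : 0 ≤ M.discSize i * θ := by positivity
  have h3 : ⌊M.discSize i * θ⌋₊ < M.discSize i := by
    rw [Nat.floor_lt h2]
    nlinarith
  refine ⟨⟨⌊M.discSize i * θ⌋₊, h3⟩, ⟨M.discSize i * θ - ⌊M.discSize i * θ⌋₊, ?_, ?_⟩, ?_⟩
  · exact sub_nonneg.2 (Nat.floor_le h2)
  · have := Nat.lt_floor_add_one (M.discSize i * θ)
    linarith
  · refine congrArg boundaryPoint ?_
    change ((⌊M.discSize i * θ⌋₊ : ℝ) + (M.discSize i * θ - ⌊M.discSize i * θ⌋₊)) / _ = θ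
    rw [add_sub_cancel, mul_div_cancel_left₀ _ hs.ne']

/-- Points in the interior of an arc lie on no other arc. -/
lemma arc_injective {i : Fin m} {k l : Fin (M.discSize i)} {t u : unitInterval} (ht0 : t ≠ 0)
    (ht1 : t ≠ 1) (h : arc (M := M) i k t = arc i l u) : k = l ∧ t = u := by
  have hs : (0 : ℝ) < M.discSize i := by exact_mod_cast k.pos
  obtain ⟨a, ha⟩ := boundaryPoint_eq_iff.1 h
  have h1 : (k : ℝ) + t = l + u + a * M.discSize i := by
    field_simp at ha
    linarith
  have t0 : (0 : ℝ) < t := unitInterval.pos_iff_ne_zero.2 ht0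
  have t1 : (t : ℝ) < 1 := unitInterval.lt_one_iff_ne_one.2 ht1
  have u0 : (0 : ℝ) ≤ u := u.2.1
  have u1 : (u : ℝ) ≤ 1 := u.2.2
  have k1 : (k : ℝ) + 1 ≤ M.discSize i := by exact_mod_cast k.2
  have l1 : (l : ℝ) + 1 ≤ M.discSize i := by exact_mod_cast l.2
  have k0 : (0 : ℝ) ≤ (k : ℕ) := Nat.cast_nonneg _
  have l0 : (0 : ℝ) ≤ (l : ℕ) := Nat.cast_nonneg _
  have a0 : a = 0 := by
    by_contra ha
    rcases lt_or_gt_of_ne ha with ha | ha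
    · have : (a : ℝ) ≤ -1 := by exact_mod_cast Int.le_sub_one_of_lt ha
      nlinarith
    · have : (1 : ℝ) ≤ a := by exact_mod_cast ha
      nlinarith
  rw [a0, Int.cast_zero, zero_mul, add_zero] at h1
  have h2 : (k : ℕ) = l := by
    have b1 : ((k : ℕ) : ℝ) < (l : ℕ) + 1 := by linarith
    have b2 : ((l : ℕ) : ℝ) < (k : ℕ) + 1 := by linarith
    have b1' : (k : ℕ) < l + 1 := by exact_mod_cast b1
    have b2' : (l : ℕ) < k + 1 := by exact_mod_cast b2
    omega
  refine ⟨Fin.ext h2, Subtype.ext ?_⟩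
  rw [h2] at h1
  linarith

lemma proj_disc_mem (i : Fin m) {z : Disc} (hz : ‖z.1‖ = 1) : E.proj (disc i z) ∈ E.skeleton := by
  by_cases hi : M.discSize i = 0
  · obtain ⟨θ, -, -, rfl⟩ := exists_boundaryPoint hz
    rw [show E.proj (disc i (boundaryPoint θ)) = E.proj vertex from
      Quot.sound (.disc_collapse i hi θ)]
    exact E.proj_vertex_mem
  · obtain ⟨k, t, rfl⟩ := exists_arc i hi hz
    rw [proj_disc_arc]
    exact E.proj_edge_mem _ _

open Classical in
/-- The point of the interior of a disc which represents a point of the complex, if any. This is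
well-defined because the gluing does not involve the interiors of discs. -/
noncomputable def interiorPoint : E.toComplex → Option (Fin m × Disc) :=
  Quot.lift (fun c => match c with
    | Sum.inr (Sum.inr p) => if ‖p.2.1‖ = 1 then none else some p
    | _ => none) (by
    rintro _ _ (_ | _ | ⟨i, k, t, -⟩ | ⟨i, k, t, -⟩ | ⟨i, -, θ⟩)
    · rfl
    · rfl
    all_goals exact if_pos (norm_boundaryPoint _))

lemma interiorPoint_discMap {p : Fin m × Disc} (hp : p ∉ circles (Fin m)) :
    E.interiorPoint (E.discMap p) = some p :=
  if_neg hp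

lemma interiorPoint_of_mem {x : E.toComplex} (hx : x ∈ E.skeleton) : E.interiorPoint x = none := by
  obtain ⟨_ | _, rfl⟩ := hx <;> rfl

lemma discMap_preimage : E.discMap ⁻¹' E.skeleton = circles (Fin m) := by
  ext p
  refine ⟨fun h => ?_, fun h => E.proj_disc_mem p.1 h⟩
  by_contra hp
  have h1 := E.interiorPoint_of_mem h
  rw [E.interiorPoint_discMap hp] at h1
  cases h1

lemma isClosed_iff {Z : Set E.toComplex} : IsClosed Z ↔
    IsClosed {p : Fin n × unitInterval | E.proj (edge p.1 p.2) ∈ Z} ∧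
      IsClosed (E.discMap ⁻¹' Z) := by
  have h : Topology.IsQuotientMap E.proj := isQuotientMap_quot_mk
  rw [← h.isClosed_preimage, isClosed_sum_iff, isClosed_sum_iff]
  exact ⟨fun h => h.2, fun h => ⟨isClosed_discrete _, h⟩⟩

/-- The complex arises from its one-skeleton by attaching discs. -/
lemma isAttaching_discMap : IsAttaching E.discMap (circles (Fin m)) E.skeleton where
  continuous := E.continuous_discMap
  isClosed := by
    have hc : Continuous fun p : Fin m × Disc => ‖p.2.1‖ := by fun_prop
    exact isClosed_eq hc continuous_const
  preimage := E.discMap_preimage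
  injOn p hp q hq h := by
    have h1 := congrArg E.interiorPoint h
    rw [E.interiorPoint_discMap hp, E.interiorPoint_discMap hq] at h1
    exact Option.some_injective _ h1
  exists_eq x hx := by
    induction x using Quot.ind with
    | mk c =>
      rcases c with c | c | c
      · exact absurd E.proj_vertex_mem hx
      · exact absurd (E.proj_edge_mem _ _) hx
      · exact ⟨c, rfl⟩
  isClosed_of Z h1 h2 := E.isClosed_iff.2 ⟨h1.preimage E.continuous_edgeMap, h2⟩

/-- The condition that a point of the complex is represented by a given point `p` in the interior of
an edge. A point of a disc satisfies it if it lies on an arc at a parameter glued to `p`. -/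
def IsEdgePoint (p : Fin n × unitInterval) (hp : p ∉ endpoints (Fin n)) : E.toComplex → Prop :=
  Quot.lift (fun c => match c with
    | Sum.inl _ => False
    | Sum.inr (Sum.inl q) => q = p
    | Sum.inr (Sum.inr q) => ∃ k t, q.2 = arc (M := M) q.1 k t ∧
        (E.label q.1 k, E.arcParam q.1 k t) = p) (by
    have key : ∀ i (k : Fin (M.discSize i)) t, (∃ l u, arc (M := M) i k t = arc i l u ∧
        (E.label i l, E.arcParam i l u) = p) ↔ (E.label i k, E.arcParam i k t) = p := by
      refine fun i k t => ⟨?_, fun h => ⟨k, t, rfl, h⟩⟩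
      rintro ⟨l, u, h1, rfl⟩
      have hu : u ≠ 0 ∧ u ≠ 1 := by
        constructor <;> rintro rfl <;> refine hp ?_ <;> by_cases h : 0 < M i (E.label i l) <;>
          simp [endpoints, arcParam, h]
      obtain ⟨rfl, rfl⟩ := arc_injective hu.1 hu.2 h1.symm
      rfl
    rintro _ _ (j | j | ⟨i, k, t, h⟩ | ⟨i, k, t, h⟩ | ⟨i, h, θ⟩)
    · exact eq_false (by rintro rfl; exact hp (Or.inl rfl))
    · exact eq_false (by rintro rfl; exact hp (Or.inr rfl))
    · refine propext ((key i k t).trans ?_)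
      rw [arcParam, if_pos h]
      rfl
    · refine propext ((key i k t).trans ?_)
      rw [arcParam, if_neg h.not_gt]
      rfl
    · refine eq_false ?_
      rintro ⟨k, -⟩
      exact (h ▸ k).elim0)

/-- The set consisting of the vertex, in the one-skeleton. -/
def vertexSet : Set E.skeleton := {⟨E.proj vertex, E.proj_vertex_mem⟩}

lemma edgeMap_preimage : E.edgeMap ⁻¹' E.vertexSet = endpoints (Fin n) := by
  ext p
  constructor
  · intro h
    by_contra hp
    have h1 : E.proj (edge p.1 p.2) = E.proj vertex := congrArg Subtype.val h
    have h2 : E.IsEdgePoint p hp (E.proj (edge p.1 p.2)) := rfl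
    rw [h1] at h2
    exact h2
  · obtain ⟨j, t⟩ := p
    rintro (h | h) <;> simp only at h <;> subst h
    · exact Subtype.ext (E.proj_edge_zero j)
    · exact Subtype.ext (E.proj_edge_one j)

/-- The one-skeleton arises from the vertex by attaching the edges. -/
lemma isAttaching_edgeMap : IsAttaching E.edgeMap (endpoints (Fin n)) E.vertexSet where
  continuous := E.continuous_edgeMap
  isClosed := (isClosed_eq continuous_snd continuous_const).union
      (isClosed_eq continuous_snd continuous_const)
  preimage := E.edgeMap_preimage
  injOn p hp q hq h := by
    have h1 : E.proj (edge p.1 p.2) = E.proj (edge q.1 q.2) := congrArg Subtype.val h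
    have h2 : E.IsEdgePoint p hp (E.proj (edge p.1 p.2)) := rfl
    rw [h1] at h2
    exact h2.symm
  exists_eq x hx := by
    obtain ⟨_, c | c, rfl⟩ := x
    · exact absurd rfl hx
    · exact ⟨c, rfl⟩
  isClosed_of Z _ hZ := by
    -- It suffices that the image of `Z` in the complex is closed.
    have h1 : IsClosed (Subtype.val '' Z) := by
      rw [isClosed_iff]
      have h2 : {p : Fin n × unitInterval | E.proj (edge p.1 p.2) ∈ Subtype.val '' Z} =
          E.edgeMap ⁻¹' Z := by
        ext p
        constructor
        · rintro ⟨x, hx, hxp⟩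
          have : x = E.edgeMap p := Subtype.ext hxp
          exact this.subst (motive := fun y => y ∈ Z) hx
        · exact fun h => ⟨_, h, rfl⟩
      rw [h2]
      refine ⟨hZ, ?_⟩
      -- Its preimage in the discs is a finite union of closed subsets of boundary arcs and of
      -- boundary circles which are collapsed to the vertex.
      have h3 : E.discMap ⁻¹' (Subtype.val '' Z) =
          (⋃ i, ⋃ k, (fun t => (i, arc (M := M) i k t)) ''
            ((fun t => E.edgeMap (E.label i k, E.arcParam i k t)) ⁻¹' Z)) ∪
          ⋃ i, {p | (M.discSize i = 0 ∧ ⟨E.proj vertex, E.proj_vertex_mem⟩ ∈ Z) ∧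
            p.1 = i ∧ ‖p.2.1‖ = 1} := by
        ext ⟨i, z⟩
        simp only [Set.mem_union, Set.mem_iUnion]
        constructor
        · rintro ⟨x, hx, hxz⟩
          have hz : ‖z.1‖ = 1 := E.discMap_preimage.le (hxz ▸ x.2 : E.discMap (i, z) ∈ E.skeleton)
          by_cases hi : M.discSize i = 0
          · refine Or.inr ⟨i, ⟨hi, ?_⟩, rfl, hz⟩
            obtain ⟨θ, -, -, rfl⟩ := exists_boundaryPoint hz
            have : x = ⟨E.proj vertex, E.proj_vertex_mem⟩ :=
              Subtype.ext (hxz.trans (Quot.sound (.disc_collapse i hi θ)))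
            exact this.subst (motive := fun y => y ∈ Z) hx
          · obtain ⟨k, t, rfl⟩ := exists_arc i hi hz
            refine Or.inl ⟨i, k, t, ?_, rfl⟩
            have : x = E.edgeMap (E.label i k, E.arcParam i k t) :=
              Subtype.ext (hxz.trans (E.proj_disc_arc i k t))
            exact this.subst (motive := fun y => y ∈ Z) hx
        · rintro (⟨j, k, t, ht, h⟩ | ⟨j, ⟨hj, hZ⟩, rfl, hz⟩)
          · obtain ⟨rfl, rfl⟩ := Prod.ext_iff.1 h
            exact ⟨_, ht, (E.proj_disc_arc _ k t).symm⟩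
          · obtain ⟨θ, -, -, rfl⟩ := exists_boundaryPoint hz
            exact ⟨_, hZ, (Quot.sound (.disc_collapse i hj θ)).symm⟩
      rw [h3]
      refine (isClosed_iUnion_of_finite fun i => isClosed_iUnion_of_finite fun k => ?_).union
        (isClosed_iUnion_of_finite fun i => isClosed_const.and (IsClosed.and ?_ ?_))
      · have ha : Continuous fun t => (i, arc (M := M) i k t) :=
          Continuous.prodMk continuous_const (continuous_boundaryPoint.comp (by fun_prop))
        exact ha.isClosedMap _ (hZ.preimage (f := fun t => (E.label i k, E.arcParam i k t))
          (by have := E.continuous_arcParam i k; fun_prop))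
      · exact isClosed_eq continuous_fst continuous_const
      · have hc : Continuous fun p : Fin m × Disc => ‖p.2.1‖ := by fun_prop
        exact isClosed_eq hc continuous_const
    convert h1.preimage continuous_subtype_val
    exact (Set.preimage_image_eq Z Subtype.val_injective).symm

end EdgeOrdering

/-! ### The boundary loops of the discs -/

/-- The submodule of one-dimensional boundaries. -/
noncomputable def boundaries (X : TopCat.{0}) : Submodule ℤ ((singChains.obj X).X 1) :=
  LinearMap.range ((singChains.obj X).d 2 1).hom

lemma map_mem_boundaries {X Y : TopCat.{0}} (f : X ⟶ Y) {x : (singChains.obj X).X 1}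
    (hx : x ∈ boundaries X) : (singChains.map f).f 1 x ∈ boundaries Y := by
  obtain ⟨c, rfl⟩ := hx
  exact ⟨(singChains.map f).f 2 c, comm_apply _ _ _ _⟩

/-- The first homology of a contractible space vanishes. -/
lemma mem_boundaries_of_contractible {Y : Type} [TopologicalSpace Y] [ContractibleSpace Y]
    {y : (singChains.obj (TopCat.of Y)).X 1} (hy : (singChains.obj (TopCat.of Y)).d 1 0 y = 0) :
    y ∈ boundaries (TopCat.of Y) := by
  obtain ⟨y₀⟩ : Nonempty Y := inferInstance
  let s : TopCat.of Y ⟶ TopCat.of (Unit × Y) := TopCat.ofHom ⟨fun y => ((), y), by fun_prop⟩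
  let r : TopCat.of (Unit × Y) ⟶ TopCat.of Y := TopCat.ofHom ⟨Prod.snd, by fun_prop⟩
  have q := quasiIso_discrete_prod (F := Unit) y₀
  obtain ⟨c, hc⟩ := exists_d_eq_of_quasiIso_triple₀
    (comb fun i => point (X := TopCat.of (Unit × Y)) (i, y₀)) 0 ((singChains.map s).f 1 y) (by
      rw [comm_apply, hy, map_zero])
  have h : (singChains.map r).f 1 ((singChains.map s).f 1 y) = y := by
    change (singChains.map s ≫ singChains.map r).f 1 y = y
    rw [← Functor.map_comp, show s ≫ r = 𝟙 _ from rfl, CategoryTheory.Functor.map_id]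
    rfl
  rw [← h]
  exact map_mem_boundaries r ⟨c, hc⟩

/-- A path and its reverse cancel up to a boundary. -/
lemma path_symm_add_path_mem {X : TopCat.{0}} (γ : C(unitInterval, X)) :
    path (γ.comp ⟨unitInterval.symm, unitInterval.continuous_symm⟩) + path γ ∈ boundaries X := by
  -- It suffices to treat the identity of the interval, which is contractible.
  have h : path (X := TopCat.of unitInterval) ⟨unitInterval.symm, unitInterval.continuous_symm⟩ +
      path (X := TopCat.of unitInterval) (.id _) ∈ boundaries (TopCat.of unitInterval) := by
    refine mem_boundaries_of_contractible ?_
    rw [map_add, d_path, d_path]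
    simp
  have h1 := map_mem_boundaries (TopCat.ofHom γ) h
  rwa [map_add, map_path, map_path] at h1

/-- The affine path in the real line from `a` to `b`. -/
noncomputable def segmentPath (a b : ℝ) : C(unitInterval, TopCat.of ℝ) :=
  ⟨fun t => a + (b - a) * t, by fun_prop⟩

/-- A subdivided path is homologous to the sum of its parts. -/
lemma path_sub_sum_mem {X : TopCat.{0}} (γ : C(ℝ, X)) (s : ℕ) (u : ℕ → ℝ) :
    path (γ.comp (segmentPath (u 0) (u s))) -
      ∑ k ∈ Finset.range s, path (γ.comp (segmentPath (u k) (u (k + 1)))) ∈ boundaries X := by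
  -- In the real line, which is contractible, the difference is a cycle and hence a boundary.
  have h : path (segmentPath (u 0) (u s)) -
      ∑ k ∈ Finset.range s, path (segmentPath (u k) (u (k + 1))) ∈ boundaries (TopCat.of ℝ) := by
    refine mem_boundaries_of_contractible ?_
    have hseg : ∀ a b, (singChains.obj (TopCat.of ℝ)).d 1 0 (path (segmentPath a b)) =
        point (X := TopCat.of ℝ) b - point (X := TopCat.of ℝ) a := by
      intro a b
      rw [d_path]
      simp [segmentPath]
    rw [map_sub, map_sum, hseg, Finset.sum_congr rfl fun k _ => hseg (u k) (u (k + 1)),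
      Finset.sum_range_sub (fun k => point (X := TopCat.of ℝ) (u k)), sub_self]
  have h1 := map_mem_boundaries (TopCat.ofHom γ) h
  rw [map_sub, map_sum, map_path, Finset.sum_congr rfl fun k _ => map_path _ _] at h1
  exact h1

namespace EdgeOrdering

variable {m n : ℕ} {M : Matrix (Fin m) (Fin n) ℤ} (E : EdgeOrdering M)

/-- The path in the one-skeleton along an edge. -/
def edgePath (j : Fin n) : C(unitInterval, TopCat.of E.skeleton) :=
  ⟨fun t => E.edgeMap (j, t), E.continuous_edgeMap.comp (by fun_prop)⟩

/-- The boundary of a disc, as a periodic path in the one-skeleton. -/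
noncomputable def boundaryPath (i : Fin m) : C(ℝ, TopCat.of E.skeleton) :=
  ⟨fun θ => ⟨E.discMap (i, boundaryPoint θ), E.proj_disc_mem i (norm_boundaryPoint θ)⟩,
    (E.continuous_discMap.comp (Continuous.prodMk continuous_const
      continuous_boundaryPoint)).subtype_mk _⟩

/-- The part of the boundary path along an arc is, up to a boundary, the edge to which the arc is
glued, with the sign of the matrix entry. -/
lemma path_arc_sub_mem (i : Fin m) (k : Fin (M.discSize i)) :
    path ((E.boundaryPath i).comp (segmentPath ((k : ℕ) / M.discSize i)
      (((k : ℕ) + 1 : ℕ) / M.discSize i))) -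
      (M i (E.label i k)).sign • path (E.edgePath (E.label i k)) ∈
        boundaries (TopCat.of E.skeleton) := by
  have h1 : (E.boundaryPath i).comp (segmentPath ((k : ℕ) / M.discSize i)
      (((k : ℕ) + 1 : ℕ) / M.discSize i)) =
      (E.edgePath (E.label i k)).comp ⟨E.arcParam i k, E.continuous_arcParam i k⟩ := by
    refine ContinuousMap.ext fun t => ?_
    refine Subtype.ext ((congrArg (fun θ => E.proj (disc i (boundaryPoint θ))) ?_).trans
      (E.proj_disc_arc i k t))
    change ((k : ℕ) : ℝ) / M.discSize i + ((((k : ℕ) + 1 : ℕ) : ℝ) / M.discSize i -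
      ((k : ℕ) : ℝ) / M.discSize i) * t = _
    push_cast
    ring
  rw [h1]
  by_cases h : 0 < M i (E.label i k)
  · have h2 : (⟨E.arcParam i k, E.continuous_arcParam i k⟩ : C(unitInterval, unitInterval)) =
        .id _ := ContinuousMap.ext fun t => if_pos h
    rw [h2, Int.sign_eq_one_of_pos h, one_smul, ContinuousMap.comp_id, sub_self]
    exact Submodule.zero_mem _
  · have h2 : (⟨E.arcParam i k, E.continuous_arcParam i k⟩ : C(unitInterval, unitInterval)) =
        ⟨unitInterval.symm, unitInterval.continuous_symm⟩ :=
      ContinuousMap.ext fun t => if_neg h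
    rw [h2, Int.sign_eq_neg_one_of_neg (lt_of_le_of_ne (not_lt.1 h) (E.entry_label_ne_zero i k)),
      neg_one_zsmul, sub_neg_eq_add]
    exact path_symm_add_path_mem _

/-- The label `j` occurs `|M i j|` times, each time with the sign of `M i j`. -/
lemma sum_sign_label {A : Type*} [AddCommGroup A] (i : Fin m) (a : Fin n → A) :
    ∑ k, (M i (E.label i k)).sign • a (E.label i k) = ∑ j, M i j • a j := by
  rw [← Finset.sum_fiberwise_of_maps_to (t := Finset.univ) (g := E.label i)
    fun _ _ => Finset.mem_univ _]
  refine Finset.sum_congr rfl fun j _ => ?_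
  have h : ∀ k ∈ Finset.univ.filter fun k => E.label i k = j,
      (M i (E.label i k)).sign • a (E.label i k) = (M i j).sign • a j := by
    intro k hk
    rw [(Finset.mem_filter.1 hk).2]
  rw [Finset.sum_congr rfl h, Finset.sum_const, E.card_label, ← natCast_zsmul, ← mul_smul,
    mul_comm, Int.sign_mul_natAbs]

/-- The boundary loop of a disc is homologous to the combination of edges given by the row of the
matrix. -/
lemma path_boundary_sub_mem (i : Fin m) :
    path ((E.boundaryPath i).comp (segmentPath 0 1)) - ∑ j, M i j • path (E.edgePath j) ∈
      boundaries (TopCat.of E.skeleton) := by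
  by_cases hi : M.discSize i = 0
  · have h1 : ∀ j, M i j = 0 := by
      intro j
      have := Finset.sum_eq_zero_iff.1 hi j (Finset.mem_univ j)
      exact Int.natAbs_eq_zero.1 this
    have h2 : (E.boundaryPath i).comp (segmentPath 0 1) =
        (E.boundaryPath i).comp (segmentPath 0 0) := by
      refine ContinuousMap.ext fun t => ?_
      exact Subtype.ext ((Quot.sound (Glue.disc_collapse i hi _)).trans
        (Quot.sound (Glue.disc_collapse i hi _)).symm)
    -- The boundary is attached by a constant path, which is homologous to an empty sum of paths.
    have h3 := path_sub_sum_mem (E.boundaryPath i) 0 fun _ => 0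
    rw [Finset.sum_range_zero, sub_zero] at h3
    rw [h2, Finset.sum_eq_zero (fun j _ => by rw [h1 j, zero_smul]), sub_zero]
    exact h3
  · have h1 := path_sub_sum_mem (E.boundaryPath i) (M.discSize i) fun k => k / M.discSize i
    rw [Nat.cast_zero, zero_div, div_self (by exact_mod_cast hi), Finset.sum_range] at h1
    have h2 := Submodule.sum_mem _ fun k (_ : k ∈ Finset.univ) => E.path_arc_sub_mem i k
    rw [Finset.sum_sub_distrib, E.sum_sign_label i fun j => path (E.edgePath j)] at h2
    have h3 := Submodule.add_mem _ h1 h2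
    rwa [sub_add_sub_cancel] at h3

/-- The second boundary map of the cellular chain complex. -/
noncomputable abbrev rowMap (M : Matrix (Fin m) (Fin n) ℤ) : freeOn (Fin m) ⟶ freeOn (Fin n) :=
  ModuleCat.ofHom M.vecMulLinear

/-- The cellular chain complex of a matrix disc complex computes its singular homology. -/
theorem exists_quasiIso_toComplex :
    ∃ φ : triple (rowMap M) (0 : freeOn (Fin n) ⟶ freeOn Unit) comp_zero ⟶
      singChains.obj (TopCat.of E.toComplex), QuasiIso φ := by
  let v : Unit → E.vertexSet := fun _ => ⟨_, rfl⟩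
  have hv : v.Bijective := ⟨fun _ _ _ => rfl, fun x => ⟨(), Subtype.ext x.2.symm⟩⟩
  have : Finite E.vertexSet := Finite.of_surjective v hv.2
  have : Subsingleton E.vertexSet := ⟨fun x y => Subtype.ext (x.2.trans y.2.symm)⟩
  obtain ⟨hd, h1⟩ := quasiIso_graph v hv E.isAttaching_edgeMap fun j =>
    Subtype.ext ((E.proj_edge_one j).trans (E.proj_edge_zero j).symm)
  refine E.isAttaching_discMap.exists_quasiIso h1 fun i => ?_
  have h2 := Submodule.neg_mem _ (E.path_boundary_sub_mem i)
  rw [neg_sub] at h2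
  obtain ⟨c, hc⟩ := h2
  refine ⟨c, hc.trans (congrArg₂ (· - ·) ?_ ?_)⟩
  · refine Eq.trans ?_ (comb_apply (fun j => path (E.edgePath j)) _).symm
    refine Finset.sum_congr rfl fun j _ => ?_
    have : rowMap M (Pi.single i 1 : Fin m → ℤ) = M.row i := Matrix.single_one_vecMul i M
    exact congrArg (fun x : Fin n → ℤ => x j • path (E.edgePath j)) this.symm
  · rw [map_path]
    refine congrArg path (ContinuousMap.ext fun t => Subtype.ext ?_)
    change E.proj (disc i (boundaryPoint (0 + (1 - 0) * t))) = E.proj (disc i (boundaryPoint t))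
    rw [sub_zero, one_mul, zero_add]

end EdgeOrdering

/-! ### The homology of the cellular chain complex -/

/-- A linear surjection from the cycles whose kernel consists of the boundaries identifies the
homology. -/
lemma nonempty_homology_equiv {R : Type} [Ring R] (S : ShortComplex (ModuleCat.{0} R))
    {P : Type} [AddCommGroup P] [Module R P] (p : LinearMap.ker S.g.hom →ₗ[R] P)
    (hp : Function.Surjective p) (h : ∀ x, p x = 0 ↔ ∃ y, S.f y = x.1) :
    Nonempty (S.homology ≃ₗ[R] P) := by
  have hr : LinearMap.range S.moduleCatToCycles = LinearMap.ker p := by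
    ext x
    rw [LinearMap.mem_ker, h]
    exact exists_congr fun y => ⟨fun h => congrArg Subtype.val h, fun h => Subtype.ext h⟩
  exact ⟨S.moduleCatHomologyIso.toLinearEquiv ≪≫ₗ
    Submodule.quotEquivOfEq _ _ hr ≪≫ₗ p.quotKerEquivOfSurjective hp⟩

lemma nonempty_homology_equiv_of_iso (K : ChainComplex (ModuleCat.{0} ℤ) ℕ) {i j k : ℕ}
    (hi : (ComplexShape.down ℕ).prev j = i) (hk : (ComplexShape.down ℕ).next j = k)
    {S : ShortComplex (ModuleCat.{0} ℤ)} (e : K.sc' i j k ≅ S) :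
    Nonempty (K.homology j ≃ₗ[ℤ] S.homology) :=
  ⟨(K.homologyIsoSc' i j k hi hk ≪≫ ShortComplex.homologyMapIso e).toLinearEquiv⟩

section

variable {m n : ℕ} (M : Matrix (Fin m) (Fin n) ℤ)

/-- The cellular chain complex of the matrix disc complexes. It depends on the matrix only, and not
on an edge ordering. -/
noncomputable abbrev cellChains : ChainComplex (ModuleCat.{0} ℤ) ℕ :=
  triple (EdgeOrdering.rowMap M) (0 : freeOn (Fin n) ⟶ freeOn Unit) comp_zero

lemma cellChains_d (k : ℕ) : (cellChains M).d (k + 1) k =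
    tripleD (EdgeOrdering.rowMap M) (0 : freeOn (Fin n) ⟶ freeOn Unit) k :=
  triple.d_eq k

lemma nonempty_homology_cellChains_zero : Nonempty ((cellChains M).homology 0 ≃ₗ[ℤ] ℤ) := by
  let S : ShortComplex (ModuleCat.{0} ℤ) :=
    .mk (0 : freeOn (Fin n) ⟶ freeOn Unit) (0 : freeOn Unit ⟶ freeOn Unit) comp_zero
  have e : (cellChains M).sc' 1 0 0 ≅ S :=
    ShortComplex.isoMk (Iso.refl _) (Iso.refl _) (Iso.refl _)
      ((Category.id_comp _).trans ((Category.comp_id _).trans (cellChains_d M 0)).symm)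
      ((Category.id_comp _).trans
        ((Category.comp_id _).trans ((cellChains M).shape 0 0 (by simp))).symm)
  have h : Nonempty (S.homology ≃ₗ[ℤ] ℤ) := by
    refine nonempty_homology_equiv S
      ((LinearMap.proj (R := ℤ) (φ := fun _ : Unit => ℤ) ()) ∘ₗ Submodule.subtype _)
      (fun x => ⟨⟨fun _ => x, rfl⟩, rfl⟩) fun x => ⟨fun h => ⟨0, ?_⟩, ?_⟩
    · rw [map_zero]
      exact funext fun _ => h.symm
    · rintro ⟨y, hy⟩
      exact (congrFun hy ()).symm
  exact (nonempty_homology_equiv_of_iso _ (by simp) (by simp) e).map2 (· ≪≫ₗ ·) h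

lemma nonempty_homology_cellChains_one : Nonempty ((cellChains M).homology 1 ≃ₗ[ℤ]
    (Fin n → ℤ) ⧸ Submodule.span ℤ (Set.range M.row)) := by
  let S : ShortComplex (ModuleCat.{0} ℤ) :=
    .mk (EdgeOrdering.rowMap M) (0 : freeOn (Fin n) ⟶ freeOn Unit) comp_zero
  have e : (cellChains M).sc' 2 1 0 ≅ S :=
    ShortComplex.isoMk (Iso.refl _) (Iso.refl _) (Iso.refl _)
      ((Category.id_comp _).trans ((Category.comp_id _).trans (cellChains_d M 1)).symm)
      ((Category.id_comp _).trans ((Category.comp_id _).trans (cellChains_d M 0)).symm)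
  have h : Nonempty (S.homology ≃ₗ[ℤ]
      (Fin n → ℤ) ⧸ Submodule.span ℤ (Set.range M.row)) := by
    refine nonempty_homology_equiv S
      ((Submodule.span ℤ (Set.range M.row)).mkQ ∘ₗ Submodule.subtype _) (fun x => ?_) fun x => ?_
    · obtain ⟨x, rfl⟩ := Submodule.mkQ_surjective _ x
      exact ⟨⟨x, rfl⟩, rfl⟩
    · refine (Submodule.Quotient.mk_eq_zero _).trans ?_
      rw [← range_vecMulLinear]
      rfl
  exact (nonempty_homology_equiv_of_iso _ (by simp) (by simp) e).map2 (· ≪≫ₗ ·) h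

lemma nonempty_homology_cellChains_two :
    Nonempty ((cellChains M).homology 2 ≃ₗ[ℤ] LinearMap.ker M.vecMulLinear) := by
  let S : ShortComplex (ModuleCat.{0} ℤ) :=
    .mk (0 : zeroMod ⟶ freeOn (Fin m)) (EdgeOrdering.rowMap M) zero_comp
  have e : (cellChains M).sc' 3 2 1 ≅ S :=
    ShortComplex.isoMk (Iso.refl _) (Iso.refl _) (Iso.refl _)
      ((Category.id_comp _).trans ((Category.comp_id _).trans (cellChains_d M 2)).symm)
      ((Category.id_comp _).trans ((Category.comp_id _).trans (cellChains_d M 1)).symm)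
  have h : Nonempty (S.homology ≃ₗ[ℤ] LinearMap.ker M.vecMulLinear) := by
    refine nonempty_homology_equiv S LinearMap.id Function.surjective_id fun x =>
      ⟨fun h => ⟨0, ?_⟩, ?_⟩
    · rw [map_zero]
      exact (congrArg Subtype.val h).symm
    · rintro ⟨y, hy⟩
      exact Subtype.ext hy.symm
  exact (nonempty_homology_equiv_of_iso _ (by simp) (by simp) e).map2 (· ≪≫ₗ ·) h

lemma subsingleton_homology_cellChains (k : ℕ) :
    Subsingleton ((cellChains M).homology (k + 3)) := by
  refine ModuleCat.subsingleton_of_isZero ?_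
  rw [← exactAt_iff_isZero_homology]
  exact (exactAt_succ_iff (k + 2)).2 fun y _ => ⟨0, Subsingleton.elim (α := PUnit) _ _⟩

variable {M}

lemma nonempty_integerHomology_equiv (E : EdgeOrdering M) (k : ℕ) :
    Nonempty (integerHomology k (TopCat.of E.toComplex) ≃ₗ[ℤ] (cellChains M).homology k) := by
  obtain ⟨φ, hφ⟩ := E.exists_quasiIso_toComplex
  exact ⟨(((homologyFunctor _ _ k).mapIso (singChainsIso.app (TopCat.of E.toComplex))) ≪≫
    (asIso (homologyMap φ k)).symm).toLinearEquiv⟩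

end

theorem lemma1 {m n : ℕ} (M : Matrix (Fin m) (Fin n) ℤ) :
    (∀ C ∈ M.DC, ∀ C' ∈ M.DC, ∀ k : ℕ,
      Nonempty (integerHomology k C ≃ₗ[ℤ] integerHomology k C')) ∧
    (∀ C ∈ M.DC,
      Nonempty (integerHomology 0 C ≃ₗ[ℤ] ℤ) ∧
      Nonempty (integerHomology 1 C ≃ₗ[ℤ] (Fin n → ℤ) ⧸ Submodule.span ℤ (Set.range M.row)) ∧
      Nonempty (integerHomology 2 C ≃ₗ[ℤ] LinearMap.ker M.vecMulLinear) ∧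
      ∀ k : ℕ, 3 ≤ k → Subsingleton (integerHomology k C)) := by
  constructor
  · rintro _ ⟨E, rfl⟩ _ ⟨E', rfl⟩ k
    obtain ⟨e⟩ := nonempty_integerHomology_equiv E k
    obtain ⟨e'⟩ := nonempty_integerHomology_equiv E' k
    exact ⟨e ≪≫ₗ e'.symm⟩
  · rintro _ ⟨E, rfl⟩
    have e := fun k => nonempty_integerHomology_equiv E k
    refine ⟨(e 0).map2 (· ≪≫ₗ ·) (nonempty_homology_cellChains_zero M),
      (e 1).map2 (· ≪≫ₗ ·) (nonempty_homology_cellChains_one M),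
      (e 2).map2 (· ≪≫ₗ ·) (nonempty_homology_cellChains_two M), fun k hk => ?_⟩
    obtain ⟨l, rfl⟩ := Nat.exists_eq_add_of_le' hk
    obtain ⟨e⟩ := e (l + 3)
    have := subsingleton_homology_cellChains M l
    exact e.toEquiv.subsingleton
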